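/- **Conventions.** Composition is written in diagrammatic order ($fg$ is first $f$, then $g$). Let $\mathbb X$ be a Cartesian category, i.e. a category with specified finite products, with projections $\pi_0,\pi_1,\dots$. For a commutative monoid $(A,+,0)$ in $\mathbb X$ the maps $T\to A$ form a commutative monoid, with $f+g=\langle f,g\rangle +$ and with zero $T\to 1\xrightarrow{0}A$. A map $u:A\to B$ between commutative monoids $(A,+_A,0_A)$, $(B,+_B,0_B)$ is *additive* if $+_A\,u=(u\times u)+_B$ and $0_A\,u=0_B$. **The category $\mathrm{Fa\grave a}(\mathbb X)$.** An object is a pair $((A,+,0),X)$ of a commutative monoid in $\mathbb X$ and an object of $\mathbb X$. A morphism $((A,+,0),X)\to((B,+,0),Y)$ is a sequence $f=(f_*,f_1,f_2,\dots)$ with $f_*:X\to Y$ and, for $n\ge 1$, $f_n:A^n\times X\to B$ additive in each of the first $n$ arguments and invariant under permutations of them. Composition is given by $(fg)_*=f_*g_*$ and the Faà di Bruno formula: on generalized elements, $$(fg)_n(a_1,\dots,a_n,x)=\sum_{\{B_1,\dots,B_k\}} g_k\bigl(f_{|B_1|}(a_{B_1},x),\dots,f_{|B_k|}(a_{B_k},x),f_*(x)\bigr),$$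 where the sum is over all partitions of $\{1,\dots,n\}$ into nonempty blocks and $a_{B}$ is the list of the $a_i$ with $i\in B$. The identity is $(1,\pi_0,0,0,\dots)$. Finite products are $((A,+,0),X)\times((B,+,0),Y)=((A,+,0)\times(B,+,0),\,X\times Y)$, with projections $(\pi_i,\pi_0\pi_i,0,0,\dots)$. There is a functor $\lambda$ from the category of commutative monoids and additive maps of $\mathbb X$ to $\mathrm{Fa\grave a}(\mathbb X)$, with $\lambda(A,+,0)=((A,+,0),A)$ and $\lambda(u)=(u,\pi_0u,0,0,\dots)$. **Generalized Cartesian differential categories.** Such a structure on a Cartesian category assigns to every object $Z$ a commutative monoid $L(Z)=(L_0(Z),+_Z,0_Z)$ with $L(L_0(Z))=L(Z)$ and $L(Z\times W)=L(Z)\times L(W)$, and to every map $f:Z\to W$ a map $D(f):L_0(Z)\times Z\to L_0(W)$, such that 1. $D(+_Z)=\pi_0+_Z$ and $D(0_Z)=\pi_0 0_Z$ (in the latter, $0_Z:1\to L_0(Z)$ is preceded by the unique map $L_0(1)\to 1$); 2. $\langle a+b,c\rangle D(f)=\langle a,c\rangle D(f)+\langle b,c\rangle D(f)$ and $\langle 0,c\rangle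 D(f)=0$; 3. $D(\pi_i)=\pi_0\pi_i$ for the two projections $\pi_i$ of a product; 4. $D(\langle f,g\rangle)=\langle D(f),D(g)\rangle$; 5. $D(fg)=\langle D(f),\pi_1f\rangle D(g)$; 6. $\langle\langle a,0\rangle,\langle c,d\rangle\rangle D(D(f))=\langle a,d\rangle D(f)$; 7. $\langle\langle 0,b\rangle,\langle c,d\rangle\rangle D(D(f))=\langle\langle 0,c\rangle,\langle b,d\rangle\rangle D(D(f))$. An object $Z$ is *linear* if $L_0(Z)=Z$; a map $f:Z\to W$ between linear objects is *linear* if $D(f)=\pi_0f$. The category $\mathrm{Fa\grave a}(\mathbb X)$ is a generalized Cartesian differential category. For $Z=((A,+,0),X)$, the commutative monoid $L(Z)$ is the object $L_0(Z)=((A,+,0),A)$ with addition $\lambda(+)=(+,\pi_0+,0,\dots)$ and zero $\lambda(0)=(0,\pi_00,0,\dots)$. For $f=(f_*,f_1,f_2,\dots):Z\to W$, the map $D(f)$ has $D(f)_*=f_1$ and, for $n\ge 1$, at vectors $(b_i,c_i)\in A\times A$ ($1\le i\le n$) and the point $(a,x)\in A\times X$, $$D(f)_n\bigl((b_1,c_1),\dots,(b_n,c_n),(a,x)\bigr)=f_{n+1}(a,c_1,\dots,c_n,x)+\sum_{i=1}^n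 f_n(c_1,\dots,c_{i-1},b_i,c_{i+1},\dots,c_n,x).$$ **Proposition.** Let $\mathbb X$ be a Cartesian category. (i) An object of $\mathrm{Fa\grave a}(\mathbb X)$ is linear if and only if it is of the form $((A,+,0),A)=\lambda(A,+,0)$ for a commutative monoid $(A,+,0)$ in $\mathbb X$. (ii) Let $(A,+_A,0_A)$ and $(B,+_B,0_B)$ be commutative monoids in $\mathbb X$. A morphism $f:((A,+_A,0_A),A)\to((B,+_B,0_B),B)$ of $\mathrm{Fa\grave a}(\mathbb X)$ is a linear map if and only if $f=\lambda(u)=(u,\pi_0u,0,0,\dots)$ for an additive map $u$ from $(A,+_A,0_A)$ to $(B,+_B,0_B)$. -/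

import Mathlib

open CategoryTheory MonoidalCategory CartesianMonoidalCategory MonObj

universe v u

namespace FaaDiBruno

section

variable {C : Type u} [Category.{v} C] [CartesianMonoidalCategory C]

/-- `A × (A × ⋯ × (A × X))` with `n` factors `A`. -/
def pow (A X : C) : ℕ → C
  | 0 => X
  | n + 1 => A ⊗ pow A X n

/-- The map `⟨a₀, …, aₙ₋₁, x⟩ : T ⟶ Aⁿ × X`. -/
def tuple {T A X : C} : ∀ n : ℕ, (Fin n → (T ⟶ A)) → (T ⟶ X) → (T ⟶ pow A X n)
  | 0, _, x => x
  | n + 1, a, x => lift (a 0) (tuple n (fun i => a i.succ) x)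

/-- The projection `πᵢ : Aⁿ × X ⟶ A`, for `i < n`. -/
def proj {A X : C} : ∀ {n : ℕ}, Fin n → (pow A X n ⟶ A)
  | 0, i => i.elim0
  | n + 1, i => Fin.cases (fst A (pow A X n)) (fun j => snd A (pow A X n) ≫ proj j) i

/-- The last projection `πₙ : Aⁿ × X ⟶ X`. -/
def last {A X : C} : ∀ n : ℕ, (pow A X n ⟶ X)
  | 0 => 𝟙 X
  | n + 1 => snd A (pow A X n) ≫ last n

theorem comp_tuple {S T A X : C} (h : S ⟶ T) : ∀ (n : ℕ) (a : Fin n → (T ⟶ A)) (x : T ⟶ X),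
    h ≫ tuple n a x = tuple n (fun i => h ≫ a i) (h ≫ x)
  | 0, _, _ => rfl
  | n + 1, a, x => by
    show h ≫ lift _ _ = lift _ _
    rw [comp_lift, comp_tuple h n]

theorem tuple_proj {T A X : C} : ∀ {n : ℕ} (a : Fin n → (T ⟶ A)) (x : T ⟶ X) (i : Fin n),
    tuple n a x ≫ proj i = a i
  | 0, _, _, i => i.elim0
  | n + 1, a, x, i => by
    refine Fin.cases ?_ (fun j => ?_) i
    · exact lift_fst _ _
    · show lift (a 0) (tuple n (fun i => a i.succ) x) ≫ snd A (pow A X n) ≫ proj j = _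
      rw [lift_snd_assoc, tuple_proj]

theorem tuple_last {T A X : C} : ∀ {n : ℕ} (a : Fin n → (T ⟶ A)) (x : T ⟶ X),
    tuple n a x ≫ last n = x
  | 0, _, x => Category.comp_id x
  | n + 1, a, x => by
    show lift (a 0) (tuple n (fun i => a i.succ) x) ≫ snd A (pow A X n) ≫ last n = _
    rw [lift_snd_assoc, tuple_last]

theorem tuple_id {A X : C} : ∀ n : ℕ, tuple n (fun i => proj (A := A) (X := X) i) (last n) = 𝟙 _
  | 0 => rfl
  | n + 1 => by
    have : tuple n (fun i => snd A (pow A X n) ≫ proj i) (snd A (pow A X n) ≫ last n)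
        = snd A (pow A X n) := by
      rw [← comp_tuple, tuple_id n, Category.comp_id]
    show lift (fst _ _) (tuple n (fun i => snd A (pow A X n) ≫ proj i) (snd _ _ ≫ last n)) = _
    rw [this]
    exact lift_fst_snd

variable [BraidedCategory C]

/-- For a commutative monoid `(A,+,0)` in a Cartesian category and maps `f g : T ⟶ A`, the sum
`f + g` is `⟨f,g⟩ ≫ (+)`.  (Mathlib writes the operation and the unit of an internal commutative
monoid as `μ` and `η`.) -/
instance homAdd (T : C) (A : CommMon C) : Add (T ⟶ A.X) := ⟨fun f g => lift f g ≫ μ[A.X]⟩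

/-- The zero map `T ⟶ A` is `! ≫ 0`. -/
instance homZero (T : C) (A : CommMon C) : Zero (T ⟶ A.X) := ⟨toUnit T ≫ η[A.X]⟩

instance homAddCommMonoid (T : C) (A : CommMon C) : AddCommMonoid (T ⟶ A.X) where
  add_assoc f g h := (Hom.commMonoid (X := T) (M := A.X)).mul_assoc f g h
  zero_add f := (Hom.commMonoid (X := T) (M := A.X)).one_mul f
  add_zero f := (Hom.commMonoid (X := T) (M := A.X)).mul_one f
  add_comm f g := (Hom.commMonoid (X := T) (M := A.X)).mul_comm f g
  nsmul := nsmulRec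

theorem add_def {T : C} {A : CommMon C} (f g : T ⟶ A.X) : f + g = lift f g ≫ μ[A.X] := rfl

theorem zero_def (T : C) (A : CommMon C) : (0 : T ⟶ A.X) = toUnit T ≫ η[A.X] := rfl

theorem comp_add {S T : C} {A : CommMon C} (h : S ⟶ T) (f g : T ⟶ A.X) :
    h ≫ (f + g) = h ≫ f + h ≫ g := by
  rw [add_def, add_def, ← Category.assoc, comp_lift]

theorem comp_zero {S T : C} {A : CommMon C} (h : S ⟶ T) :
    h ≫ (0 : T ⟶ A.X) = 0 := by
  simp [zero_def]

theorem comp_sum {S T : C} {A : CommMon C} {κ : Type*} (s : Finset κ) (h : S ⟶ T)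
    (f : κ → (T ⟶ A.X)) : h ≫ (∑ i ∈ s, f i) = ∑ i ∈ s, h ≫ f i :=
  map_sum (⟨⟨fun k => h ≫ k, comp_zero h⟩, comp_add h⟩ : (T ⟶ A.X) →+ (S ⟶ A.X)) f s

variable (C) in
/-- Objects of `Faà(C)`: a commutative monoid in `C` together with an object of `C`. -/
structure Faa where
  /-- The commutative monoid `(A,+,0)`. -/
  mon : CommMon C
  /-- The object `X`. -/
  base : C

/-- Morphisms of `Faà(C)`: sequences `(f_*, f₁, f₂, …)`.  The entry `term n` is the map usually
written `f_{n+1} : A^{n+1} × X ⟶ B`; it is additive in each of its first `n+1` variables and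
symmetric in them. -/
@[ext]
structure Faa.Hom (Z W : Faa C) where
  star : Z.base ⟶ W.base
  term (n : ℕ) : pow Z.mon.X Z.base (n + 1) ⟶ W.mon.X
  term_add (n : ℕ) {T : C} (a : Fin (n + 1) → (T ⟶ Z.mon.X)) (x : T ⟶ Z.base) (i : Fin (n + 1))
    (b c : T ⟶ Z.mon.X) :
    tuple (n + 1) (Function.update a i (b + c)) x ≫ term n =
      tuple (n + 1) (Function.update a i b) x ≫ term n +
        tuple (n + 1) (Function.update a i c) x ≫ term n
  term_zero (n : ℕ) {T : C} (a : Fin (n + 1) → (T ⟶ Z.mon.X)) (x : T ⟶ Z.base)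
    (i : Fin (n + 1)) : tuple (n + 1) (Function.update a i 0) x ≫ term n = 0
  term_symm (n : ℕ) {T : C} (a : Fin (n + 1) → (T ⟶ Z.mon.X)) (x : T ⟶ Z.base)
    (σ : Equiv.Perm (Fin (n + 1))) :
    tuple (n + 1) (fun i => a (σ i)) x ≫ term n = tuple (n + 1) a x ≫ term n

variable {Z W V U : Faa C}

/-- The `n`-th term `fₙ : Aⁿ × X ⟶ B` for `n ≥ 1`, extended by the dummy value `0` at `n = 0`. -/
def Faa.Hom.at (f : Faa.Hom Z W) : ∀ n : ℕ, pow Z.mon.X Z.base n ⟶ W.mon.X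
  | 0 => 0
  | n + 1 => f.term n

/-- The value of `fₙ` at generalized elements. -/
def ev (f : Faa.Hom Z W) {T : C} {n : ℕ} (a : Fin n → (T ⟶ Z.mon.X)) (x : T ⟶ Z.base) :
    T ⟶ W.mon.X :=
  tuple n a x ≫ f.at n

theorem ev_add (f : Faa.Hom Z W) {T : C} {n : ℕ} (a : Fin n → (T ⟶ Z.mon.X)) (x : T ⟶ Z.base)
    (i : Fin n) (b c : T ⟶ Z.mon.X) :
    ev f (Function.update a i (b + c)) x =
      ev f (Function.update a i b) x + ev f (Function.update a i c) x := by
  cases n with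
  | zero => exact i.elim0
  | succ n => exact f.term_add n a x i b c

theorem ev_zero (f : Faa.Hom Z W) {T : C} {n : ℕ} (a : Fin n → (T ⟶ Z.mon.X)) (x : T ⟶ Z.base)
    (i : Fin n) (h : a i = 0) : ev f a x = 0 := by
  cases n with
  | zero => exact i.elim0
  | succ n =>
    have := f.term_zero n a x i
    rwa [← h, Function.update_eq_self] at this

theorem ev_symm (f : Faa.Hom Z W) {T : C} {n : ℕ} (a : Fin n → (T ⟶ Z.mon.X)) (x : T ⟶ Z.base)
    (σ : Equiv.Perm (Fin n)) : ev f (fun i => a (σ i)) x = ev f a x := by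
  cases n with
  | zero => rw [Subsingleton.elim σ 1]; rfl
  | succ n => exact f.term_symm n a x σ

theorem ev_empty (f : Faa.Hom Z W) {T : C} (a : Fin 0 → (T ⟶ Z.mon.X)) (x : T ⟶ Z.base) :
    ev f a x = 0 :=
  comp_zero _

theorem hom_ext' {f g : Faa.Hom Z W} (h : f.star = g.star)
    (h' : ∀ (n : ℕ) {T : C} (a : Fin (n + 1) → (T ⟶ Z.mon.X)) (x : T ⟶ Z.base),
      ev f a x = ev g a x) : f = g := by
  refine Faa.Hom.ext h (funext fun n => ?_)
  have := h' n proj (last (n + 1))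
  simpa [ev, tuple_id, Faa.Hom.at] using this

end

section

section Partitions

variable {α M : Type*} [AddCommMonoid M]

/-- The list of blocks of a partition of the index set of `a`. -/
def blocks {n : ℕ} (c : OrderedFinpartition n) (a : Fin n → α) : List (List α) :=
  List.ofFn fun m => List.ofFn fun j => a (c.emb m j)

/-- Sum over all ways of inserting a new element into a partition. -/
def ins (Φ : List (List α) → M) (a : α) (p : List (List α)) : M :=
  Φ ([a] :: p) + ∑ m ∈ Finset.range p.length, Φ (p.modify m (fun q => a :: q))

/-- Sum over all partitions of a list, computed recursively. -/
def sumParts (Φ : List (List α) → M) : List α → M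
  | [] => Φ []
  | a :: l => sumParts (ins Φ a) l

theorem blocks_extendLeft {n : ℕ} (c : OrderedFinpartition n) (a : Fin (n + 1) → α) :
    blocks c.extendLeft a = [a 0] :: blocks c (fun i => a i.succ) := by
  refine List.ext_getElem (by simp [blocks]) fun i h1 h2 => ?_
  cases i with
  | zero =>
    refine List.ext_getElem ?_ fun j h3 h4 => ?_
    · simp [blocks]
      rfl
    · simp [blocks, OrderedFinpartition.extendLeft]
  | succ i =>
    simp only [blocks, List.getElem_ofFn, List.getElem_cons_succ]
    refine List.ext_getElem ?_ fun j h3 h4 => ?_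
    · simp; rfl
    · simp [OrderedFinpartition.extendLeft]; rfl

theorem blocks_extendMiddle {n : ℕ} (c : OrderedFinpartition n) (k : Fin c.length)
    (a : Fin (n + 1) → α) :
    blocks (c.extendMiddle k) a =
      (blocks c (fun i => a i.succ)).modify k (fun q => a 0 :: q) := by
  refine List.ext_getElem (by simp [blocks]) fun i h1 h2 => ?_
  rw [List.getElem_modify]
  have hi : i < c.length := by simpa [blocks] using h1
  by_cases hk : k = ⟨i, hi⟩
  · subst hk
    simp only [blocks, List.getElem_ofFn, if_true]
    refine List.ext_getElem ?_ fun j h3 h4 => ?_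
    · simp only [List.length_ofFn, List.length_cons, OrderedFinpartition.extendMiddle_partSize]
      exact Function.update_self ..
    · cases j with
      | zero => simp [OrderedFinpartition.extendMiddle]
      | succ j => simp [OrderedFinpartition.extendMiddle]
  · have hk' : (k : ℕ) ≠ i := fun h => hk (Fin.ext h)
    have hk2 : (⟨i, hi⟩ : Fin c.length) ≠ k := fun h => hk h.symm
    simp only [blocks, List.getElem_ofFn, if_neg hk']
    refine List.ext_getElem ?_ fun j h3 h4 => ?_
    · simp only [List.length_ofFn, OrderedFinpartition.extendMiddle_partSize]
      exact Function.update_of_ne hk2 ..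
    · simp [OrderedFinpartition.extendMiddle, hk2]

theorem sum_partitions (Φ : List (List α) → M) : ∀ (n : ℕ) (a : Fin n → α),
    ∑ c : OrderedFinpartition n, Φ (blocks c a) = sumParts Φ (List.ofFn a) := by
  intro n
  induction n generalizing Φ with
  | zero =>
    intro a
    rw [Fintype.sum_unique]
    rfl
  | succ n ih =>
    intro a
    rw [List.ofFn_succ, sumParts, ← ih, ← (OrderedFinpartition.extendEquiv n).sum_comp,
      Fintype.sum_sigma]
    refine Finset.sum_congr rfl fun c _ => ?_
    rw [Fintype.sum_option, ins]
    congr 1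
    · exact congrArg Φ (blocks_extendLeft c a)
    · have : (blocks c fun i => a i.succ).length = c.length := by simp [blocks]
      rw [this, Finset.sum_range]
      exact Finset.sum_congr rfl fun k _ => congrArg Φ (blocks_extendMiddle c k a)

/-- Invariance of a functional on lists of lists under reordering. -/
structure Inv (Φ : List (List α) → M) : Prop where
  outer : ∀ {p q}, p.Perm q → Φ p = Φ q
  inner : ∀ {p q}, List.Forall₂ List.Perm p q → Φ p = Φ q

theorem sum_modify_perm {Φ : List (List α) → M} (hΦ : ∀ {p q}, p.Perm q → Φ p = Φ q)
    (h : List α → List α) {p q : List (List α)} (hpq : p.Perm q) :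
    ∑ m ∈ Finset.range p.length, Φ (p.modify m h) =
      ∑ m ∈ Finset.range q.length, Φ (q.modify m h) := by
  induction hpq generalizing Φ with
  | nil => rfl
  | @cons x l₁ l₂ hl ih =>
    simp only [List.length_cons, Finset.sum_range_succ', List.modify_succ_cons,
      List.modify_zero_cons]
    congr 1
    · exact ih (Φ := fun p => Φ (x :: p)) fun hp => hΦ (hp.cons x)
    · exact hΦ (hl.cons _)
  | swap x y l =>
    simp only [List.length_cons, Finset.sum_range_succ', List.modify_succ_cons,
      List.modify_zero_cons]
    rw [add_right_comm]
    congr 1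
    · congr 1
      · exact Finset.sum_congr rfl fun m _ => hΦ (List.Perm.swap _ _ _)
      · exact hΦ (List.Perm.swap _ _ _)
    · exact hΦ (List.Perm.swap _ _ _)
  | trans _ _ ih1 ih2 => exact (ih1 hΦ).trans (ih2 hΦ)

theorem forall₂_modify {p q : List (List α)} (h : List.Forall₂ List.Perm p q) (a : α) (m : ℕ) :
    List.Forall₂ List.Perm (p.modify m (fun r => a :: r)) (q.modify m (fun r => a :: r)) := by
  induction h generalizing m with
  | nil => simp
  | cons h1 h2 ih =>
    cases m with
    | zero => exact .cons (h1.cons a) h2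
    | succ m => exact .cons h1 (ih m)

theorem forall₂_modify_comm (p : List (List α)) (a b : α) (m k : ℕ) :
    List.Forall₂ List.Perm ((p.modify m (fun r => a :: r)).modify k (fun r => b :: r))
      ((p.modify k (fun r => b :: r)).modify m (fun r => a :: r)) := by
  have refl : ∀ p : List (List α), List.Forall₂ List.Perm p p := fun p => by
    induction p with
    | nil => exact .nil
    | cons x p ih => exact .cons (.refl _) ih
  induction p generalizing m k with
  | nil => simp
  | cons x p ih =>
    cases m with
    | zero =>
      cases k with
      | zero => exact .cons (.swap _ _ _) (refl _)
      | succ k => exact .cons (.refl _) (refl _)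
    | succ m =>
      cases k with
      | zero => exact .cons (.refl _) (refl _)
      | succ k => exact .cons (.refl _) (ih m k)

theorem Inv.ins {Φ : List (List α) → M} (h : Inv Φ) (a : α) : Inv (ins Φ a) where
  outer hp := by
    rw [FaaDiBruno.ins, FaaDiBruno.ins, h.outer (hp.cons [a]), sum_modify_perm h.outer _ hp]
  inner hp := by
    rw [FaaDiBruno.ins, FaaDiBruno.ins, h.inner (.cons (.refl _) hp), hp.length_eq]
    congr 1
    exact Finset.sum_congr rfl fun m _ => h.inner (forall₂_modify hp a m)

theorem Inv.ins_comm {Φ : List (List α) → M} (h : Inv Φ) (a b : α) :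
    FaaDiBruno.ins (FaaDiBruno.ins Φ a) b = FaaDiBruno.ins (FaaDiBruno.ins Φ b) a := by
  have refl : ∀ p : List (List α), List.Forall₂ List.Perm p p := fun p => by
    induction p with
    | nil => exact .nil
    | cons x p ih => exact .cons (.refl _) ih
  funext p
  simp only [FaaDiBruno.ins, List.length_cons, Finset.sum_range_succ', List.modify_succ_cons,
    List.modify_zero_cons, List.length_modify, Finset.sum_add_distrib]
  rw [h.outer (List.Perm.swap [b] [a] p), h.inner (.cons (.swap b a []) (refl p))]
  rw [Finset.sum_comm (s := Finset.range p.length) (t := Finset.range p.length)]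
  have : ∀ m k, Φ ((p.modify k fun q => b :: q).modify m fun q => a :: q)
      = Φ ((p.modify m fun q => a :: q).modify k fun q => b :: q) :=
    fun m k => h.inner (forall₂_modify_comm p b a k m)
  simp only [this]
  abel

theorem sumParts_perm {Φ : List (List α) → M} (h : Inv Φ) {l l' : List α} (hl : l.Perm l') :
    sumParts Φ l = sumParts Φ l' := by
  induction hl generalizing Φ with
  | nil => rfl
  | cons x _ ih => exact ih (h.ins x)
  | swap x y l => simp only [sumParts, h.ins_comm x y]
  | trans _ _ ih1 ih2 => exact (ih1 h).trans (ih2 h)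

/-- If only partitions with at most one block contribute, a single term remains. -/
theorem sumParts_one (Φ : List (List α) → M) (h : ∀ p, 2 ≤ p.length → Φ p = 0) (a : α)
    (l : List α) : sumParts Φ (a :: l) = Φ [a :: l] := by
  induction l generalizing a Φ with
  | nil => simp [sumParts, ins]
  | cons b l ih =>
    rw [sumParts, ih]
    · simp [ins, h]
    · intro p hp
      rw [ins, h _ (by simp; lia), Finset.sum_eq_zero, add_zero]
      intro m _
      exact h _ (by simpa using hp)

/-- If only partitions into blocks of size at most one contribute, a single term remains. -/
theorem sumParts_atomic (Φ : List (List α) → M) (h : ∀ p, (∃ q ∈ p, 2 ≤ q.length) → Φ p = 0)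
    (l : List α) : sumParts Φ l = Φ (l.map fun a => [a]) := by
  induction l generalizing Φ with
  | nil => rfl
  | cons a l ih =>
    rw [sumParts, ih, ins, List.map_cons, Finset.sum_eq_zero, add_zero]
    · intro m hm
      have hm' : m < l.length := by simpa using hm
      refine h _ ⟨[a, l[m]], ?_, by simp⟩
      rw [List.mem_iff_getElem]
      exact ⟨m, by simpa using hm', by simp⟩
    · rintro p ⟨q, hq, hq2⟩
      rw [ins, h _ ⟨q, List.mem_cons_of_mem _ hq, hq2⟩, Finset.sum_eq_zero, add_zero]
      intro m _
      obtain ⟨i, hi, rfl⟩ := List.mem_iff_getElem.1 hq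
      refine h _ ⟨(p.modify m fun q => a :: q)[i]'(by simpa using hi), List.getElem_mem _, ?_⟩
      rw [List.getElem_modify]
      split_ifs
      · simp; lia
      · exact hq2

end Partitions

end

section

variable {C : Type u} [Category.{v} C] [CartesianMonoidalCategory C] [BraidedCategory C]
variable {Z W V U : Faa C}

theorem ev_equiv (f : Faa.Hom Z W) {T : C} {n m : ℕ} (e : Fin n ≃ Fin m)
    (a : Fin m → (T ⟶ Z.mon.X)) (x : T ⟶ Z.base) : ev f (fun i => a (e i)) x = ev f a x := by
  obtain rfl : n = m := Fin.equiv_iff_eq.1 ⟨e⟩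
  exact ev_symm f a x e

/-- The value of `fₙ` at a list of `n` generalized elements. -/
def evL (f : Faa.Hom Z W) {T : C} (l : List (T ⟶ Z.mon.X)) (x : T ⟶ Z.base) : T ⟶ W.mon.X :=
  ev f l.get x

theorem evL_ofFn (f : Faa.Hom Z W) {T : C} {n : ℕ} (a : Fin n → (T ⟶ Z.mon.X))
    (x : T ⟶ Z.base) : evL f (List.ofFn a) x = ev f a x := by
  rw [← ev_equiv f (finCongr (List.length_ofFn (f := a))) a x, evL]
  congr 1
  funext i
  simp
  rfl

theorem perm_equiv {α : Type*} {l l' : List α} (h : l.Perm l') :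
    ∃ e : Fin l.length ≃ Fin l'.length, ∀ i, l.get i = l'.get (e i) := by
  induction h with
  | nil => exact ⟨Equiv.refl _, fun i => rfl⟩
  | @cons x l₁ l₂ _ ih =>
    obtain ⟨e, he⟩ := ih
    refine ⟨(finSuccEquiv _).trans ((Equiv.optionCongr e).trans (finSuccEquiv _).symm), ?_⟩
    refine Fin.cases ?_ fun i => ?_
    · simp
    · simpa using he i
  | swap x y l =>
    refine ⟨Equiv.swap ⟨0, by simp⟩ ⟨1, by simp⟩, ?_⟩
    refine Fin.cases ?_ (Fin.cases ?_ fun i => ?_)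
    · rw [show (0 : Fin (y :: x :: l).length) = ⟨0, by simp⟩ from rfl, Equiv.swap_apply_left]
      rfl
    · rw [show (Fin.succ 0 : Fin (l.length + 1 + 1)) = (⟨1, by simp⟩ : Fin (y :: x :: l).length)
        from rfl, Equiv.swap_apply_right]
      rfl
    · rw [Equiv.swap_apply_of_ne_of_ne]
      · rfl
      · exact fun h => by simpa using congrArg Fin.val h
      · exact fun h => by simpa using congrArg Fin.val h
  | trans _ _ ih1 ih2 =>
    obtain ⟨e1, h1⟩ := ih1
    obtain ⟨e2, h2⟩ := ih2
    exact ⟨e1.trans e2, fun i => (h1 i).trans (h2 _)⟩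

theorem evL_perm (f : Faa.Hom Z W) {T : C} {l l' : List (T ⟶ Z.mon.X)} (h : l.Perm l')
    (x : T ⟶ Z.base) : evL f l x = evL f l' x := by
  obtain ⟨e, he⟩ := perm_equiv h
  rw [evL, evL, ← ev_equiv f e l'.get x]
  exact congrArg (fun a => ev f a x) (funext he)

theorem evL_zero (f : Faa.Hom Z W) {T : C} (l : List (T ⟶ Z.mon.X)) (x : T ⟶ Z.base)
    (h : 0 ∈ l) : evL f l x = 0 := by
  obtain ⟨i, hi⟩ := List.get_of_mem h
  exact ev_zero f _ x i hi

/-- The functional on partitions that computes the terms of a composite. -/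
def compFun (f : Faa.Hom Z W) (g : Faa.Hom W V) {T : C} (x : T ⟶ Z.base) (y : T ⟶ W.base)
    (p : List (List (T ⟶ Z.mon.X))) : T ⟶ V.mon.X :=
  evL g (p.map fun q => evL f q x) y

theorem compFun_inv (f : Faa.Hom Z W) (g : Faa.Hom W V) {T : C} (x : T ⟶ Z.base)
    (y : T ⟶ W.base) : Inv (compFun f g x y) where
  outer h := evL_perm g (h.map _) y
  inner {p q} h := by
    have : (p.map fun q => evL f q x) = q.map fun q => evL f q x := by
      induction h with
      | nil => rfl
      | cons h _ ih => rw [List.map_cons, List.map_cons, ih, evL_perm f h]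
    rw [compFun, compFun, this]

/-- The `n`-th term of a composite: the sum over all partitions of `{0,…,n-1}`, with blocks
`B₁, …, Bₖ` of sizes `i₁, …, iₖ`, of `⟨p₁ ≫ f_{i₁}, …, pₖ ≫ f_{iₖ}, πₙ ≫ f_*⟩ ≫ gₖ`, where
`pⱼ` is the tuple of the projections with index in `Bⱼ`, followed by `πₙ`. -/
noncomputable def compTerm (f : Faa.Hom Z W) (g : Faa.Hom W V) (n : ℕ) :
    pow Z.mon.X Z.base n ⟶ V.mon.X :=
  ∑ c : OrderedFinpartition n,
    tuple c.length
      (fun m => tuple (c.partSize m) (fun j => proj (c.emb m j)) (last n) ≫ f.at (c.partSize m))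
      (last n ≫ f.star) ≫ g.at c.length

theorem tuple_compTerm (f : Faa.Hom Z W) (g : Faa.Hom W V) {T : C} {n : ℕ}
    (a : Fin n → (T ⟶ Z.mon.X)) (x : T ⟶ Z.base) :
    tuple n a x ≫ compTerm f g n =
      ∑ c : OrderedFinpartition n,
        ev g (fun m => ev f (fun j => a (c.emb m j)) x) (x ≫ f.star) := by
  rw [compTerm, comp_sum]
  refine Finset.sum_congr rfl fun c _ => ?_
  simp only [← Category.assoc, comp_tuple, tuple_proj, tuple_last]
  rfl

theorem compFun_blocks (f : Faa.Hom Z W) (g : Faa.Hom W V) {T : C} {n : ℕ}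
    (c : OrderedFinpartition n) (a : Fin n → (T ⟶ Z.mon.X)) (x : T ⟶ Z.base) (y : T ⟶ W.base) :
    compFun f g x y (blocks c a) = ev g (fun m => ev f (fun j => a (c.emb m j)) x) y := by
  rw [compFun, blocks, List.map_ofFn, evL_ofFn]
  congr 1
  funext m
  exact evL_ofFn _ _ _

theorem tuple_compTerm' (f : Faa.Hom Z W) (g : Faa.Hom W V) {T : C} {n : ℕ}
    (a : Fin n → (T ⟶ Z.mon.X)) (x : T ⟶ Z.base) :
    tuple n a x ≫ compTerm f g n =
      sumParts (compFun f g x (x ≫ f.star)) (List.ofFn a) := by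
  rw [tuple_compTerm, ← sum_partitions]
  exact Finset.sum_congr rfl fun c _ => (compFun_blocks f g c a x _).symm

/-- Changing one argument only affects the block that contains it. -/
theorem block_update {α β : Type*} {n : ℕ} (c : OrderedFinpartition n) (a : Fin n → α)
    (F : ∀ {k : ℕ}, (Fin k → α) → β) (m : Fin c.length) (r : Fin (c.partSize m)) (b : α) :
    (fun m' => F fun j => Function.update a (c.emb m r) b (c.emb m' j)) =
      Function.update (fun m' => F fun j => a (c.emb m' j)) m
        (F (Function.update (fun j => a (c.emb m j)) r b)) := by
  funext m'
  by_cases h : m' = m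
  · subst h
    rw [Function.update_self]
    congr 1
    funext j
    by_cases hj : j = r
    · subst hj; simp
    · rw [Function.update_of_ne hj, Function.update_of_ne]
      exact fun h => hj ((c.emb_strictMono m').injective h)
  · rw [Function.update_of_ne h]
    congr 1
    funext j
    rw [Function.update_of_ne]
    exact c.emb_ne_emb_of_ne h

variable (Z W V) in
/-- Composition in `Faà(C)`: `(fg)_* = f_* ≫ g_*` and `(fg)ₙ` is given by the formula of Faà di
Bruno. -/
noncomputable def Faa.comp (f : Faa.Hom Z W) (g : Faa.Hom W V) : Faa.Hom Z V where
  star := f.star ≫ g.star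
  term n := compTerm f g (n + 1)
  term_add n T a x i b b' := by
    simp only [tuple_compTerm, ← Finset.sum_add_distrib]
    refine Finset.sum_congr rfl fun c _ => ?_
    obtain ⟨⟨m, r⟩, rfl⟩ := c.exists_inverse i
    simp only [block_update c a (fun a => ev f a x) m r, ev_add]
  term_zero n T a x i := by
    rw [tuple_compTerm]
    refine Finset.sum_eq_zero fun c _ => ?_
    obtain ⟨⟨m, r⟩, rfl⟩ := c.exists_inverse i
    rw [block_update c a (fun a => ev f a x) m r]
    refine ev_zero _ _ _ m ?_
    rw [Function.update_self]
    exact ev_zero _ _ _ r (Function.update_self ..)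
  term_symm n T a x σ := by
    rw [tuple_compTerm', tuple_compTerm']
    exact sumParts_perm (compFun_inv f g x _) (Equiv.Perm.ofFn_comp_perm σ a)

theorem ev_comp (f : Faa.Hom Z W) (g : Faa.Hom W V) {T : C} {n : ℕ}
    (a : Fin n → (T ⟶ Z.mon.X)) (x : T ⟶ Z.base) :
    ev (Faa.comp Z W V f g) a x =
      ∑ c : OrderedFinpartition n,
        ev g (fun m => ev f (fun j => a (c.emb m j)) x) (x ≫ f.star) := by
  cases n with
  | zero =>
    rw [ev_empty, Fintype.sum_unique]
    exact (ev_empty g _ _).symm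
  | succ n => exact tuple_compTerm f g a x

theorem ev_comp' (f : Faa.Hom Z W) (g : Faa.Hom W V) {T : C} {n : ℕ}
    (a : Fin n → (T ⟶ Z.mon.X)) (x : T ⟶ Z.base) :
    ev (Faa.comp Z W V f g) a x =
      sumParts (compFun f g x (x ≫ f.star)) (List.ofFn a) := by
  rw [ev_comp, ← tuple_compTerm, tuple_compTerm']

/-- The map of `C` underlying an additive map of commutative monoids. -/
def toHom {A B : CommMon C} (u : A ⟶ B) : A.X ⟶ B.X := u.hom.hom

theorem one_toHom {A B : CommMon C} (u : A ⟶ B) : η[A.X] ≫ toHom u = η[B.X] :=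
  u.hom.isMonHom_hom.one_hom

theorem mul_toHom {A B : CommMon C} (u : A ⟶ B) :
    μ[A.X] ≫ toHom u = (toHom u ⊗ₘ toHom u) ≫ μ[B.X] :=
  u.hom.isMonHom_hom.mul_hom

theorem toHom_injective {A B : CommMon C} {u u' : A ⟶ B} (h : toHom u = toHom u') : u = u' :=
  CommMon.hom_ext _ _ h

/-- An additive map of commutative monoids, from its underlying map. -/
def mkHom {A B : CommMon C} (f : A.X ⟶ B.X) (h1 : η[A.X] ≫ f = η[B.X])
    (h2 : μ[A.X] ≫ f = (f ⊗ₘ f) ≫ μ[B.X]) : A ⟶ B :=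
  CommMon.homMk { hom := f, isMonHom_hom := ⟨h1, h2⟩ }

theorem toHom_comp {A B D : CommMon C} (u : A ⟶ B) (u' : B ⟶ D) :
    toHom (u ≫ u') = toHom u ≫ toHom u' := rfl

/-- An additive map preserves sums of generalized elements. -/
theorem add_comp {A B : CommMon C} (u : A ⟶ B) {T : C} (a b : T ⟶ A.X) :
    (a + b) ≫ toHom u = a ≫ toHom u + b ≫ toHom u := by
  rw [add_def, add_def, Category.assoc, mul_toHom, lift_map_assoc]

theorem zero_comp {A B : CommMon C} (u : A ⟶ B) (T : C) :
    (0 : T ⟶ A.X) ≫ toHom u = 0 := by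
  rw [zero_def, zero_def, Category.assoc, one_toHom]

/-- The morphism `(v, π₀u, 0, 0, …)` given by an additive map `u` and a map `v`. -/
def Faa.lin {Z W : Faa C} (u : Z.mon ⟶ W.mon) (v : Z.base ⟶ W.base) : Faa.Hom Z W where
  star := v
  term
    | 0 => fst Z.mon.X Z.base ≫ toHom u
    | _ + 1 => 0
  term_add n T a x i b c := by
    cases n with
    | zero =>
      obtain rfl : i = 0 := Fin.fin_one_eq_zero i
      show tuple 1 _ _ ≫ _ = tuple 1 _ _ ≫ _ + tuple 1 _ _ ≫ _
      erw [lift_fst_assoc, lift_fst_assoc, lift_fst_assoc]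
      simp only [Function.update_self, add_comp]
    | succ n =>
      show _ ≫ (0 : _ ⟶ W.mon.X) = _ ≫ (0 : _ ⟶ W.mon.X) + _ ≫ (0 : _ ⟶ W.mon.X)
      simp only [comp_zero, add_zero]
  term_zero n T a x i := by
    cases n with
    | zero =>
      obtain rfl : i = 0 := Fin.fin_one_eq_zero i
      refine (lift_fst_assoc _ _ _).trans ?_
      simp only [Function.update_self, zero_comp]
    | succ n => exact comp_zero _
  term_symm n T a x σ := by
    cases n with
    | zero => obtain rfl : σ = 1 := Subsingleton.elim (α := Equiv.Perm (Fin 1)) σ 1; rfl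
    | succ n => exact (comp_zero _).trans (comp_zero _).symm

theorem ev_lin_one {Z W : Faa C} (u : Z.mon ⟶ W.mon) (v : Z.base ⟶ W.base) {T : C}
    (a : Fin 1 → (T ⟶ Z.mon.X)) (x : T ⟶ Z.base) :
    ev (Faa.lin u v) a x = a 0 ≫ toHom u :=
  lift_fst_assoc (a 0) x (toHom u)

theorem ev_lin_succ {Z W : Faa C} (u : Z.mon ⟶ W.mon) (v : Z.base ⟶ W.base) {T : C} {n : ℕ}
    (a : Fin (n + 2) → (T ⟶ Z.mon.X)) (x : T ⟶ Z.base) :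
    ev (Faa.lin u v) a x = 0 :=
  comp_zero (tuple (n + 2) a x)

theorem evL_lin_one {Z W : Faa C} (u : Z.mon ⟶ W.mon) (v : Z.base ⟶ W.base) {T : C}
    (a : T ⟶ Z.mon.X) (x : T ⟶ Z.base) : evL (Faa.lin u v) [a] x = a ≫ toHom u :=
  ev_lin_one u v _ x

theorem evL_lin_zero {Z W : Faa C} (u : Z.mon ⟶ W.mon) (v : Z.base ⟶ W.base) {T : C}
    (l : List (T ⟶ Z.mon.X)) (h : 2 ≤ l.length) (x : T ⟶ Z.base) :
    evL (Faa.lin u v) l x = 0 := by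
  match l, h with
  | _ :: _ :: _, _ => exact ev_lin_succ u v _ x

theorem ev_lin_comp (u : Z.mon ⟶ W.mon) (v : Z.base ⟶ W.base) (g : Faa.Hom W V) {T : C} {n : ℕ}
    (a : Fin n → (T ⟶ Z.mon.X)) (x : T ⟶ Z.base) :
    ev (Faa.comp Z W V (Faa.lin u v) g) a x = ev g (fun i => a i ≫ toHom u) (x ≫ v) := by
  rw [ev_comp', sumParts_atomic, compFun, List.map_map, List.map_ofFn, evL_ofFn]
  · refine congrArg (fun a => ev g a (x ≫ v)) (funext fun i => ?_)
    exact evL_lin_one u v _ x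
  · rintro p ⟨q, hq, hq2⟩
    exact evL_zero g _ _ (List.mem_map.2 ⟨q, hq, evL_lin_zero u v q hq2 x⟩)

theorem ev_comp_lin (f : Faa.Hom Z W) (u : W.mon ⟶ V.mon) (v : W.base ⟶ V.base) {T : C} {n : ℕ}
    (a : Fin n → (T ⟶ Z.mon.X)) (x : T ⟶ Z.base) :
    ev (Faa.comp Z W V f (Faa.lin u v)) a x = ev f a x ≫ toHom u := by
  cases n with
  | zero => rw [ev_empty, ev_empty]; exact (zero_comp u T).symm
  | succ n =>
    rw [ev_comp', List.ofFn_succ, sumParts_one, compFun, List.map_singleton, evL_lin_one,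
      ← List.ofFn_succ, evL_ofFn]
    intro p hp
    exact evL_lin_zero u v _ (by simpa using hp) _

/-- The product `(A × B, ex ≫ (+ × +), 0 × 0)` of two commutative monoids. -/
def prodMon (A B : CommMon C) : CommMon C := { X := A.X ⊗ B.X }

/-- The first projection of a product of commutative monoids. -/
def fstMon (A B : CommMon C) : prodMon A B ⟶ A :=
  mkHom (A := prodMon A B) (fst A.X B.X) (IsMonHom.one_hom (f := fst A.X B.X))
    (IsMonHom.mul_hom (f := fst A.X B.X))

/-- The second projection of a product of commutative monoids. -/
def sndMon (A B : CommMon C) : prodMon A B ⟶ B :=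
  mkHom (A := prodMon A B) (snd A.X B.X) (IsMonHom.one_hom (f := snd A.X B.X))
    (IsMonHom.mul_hom (f := snd A.X B.X))

/-- Generalized elements of a product of commutative monoids. -/
def pairMon {A B : CommMon C} {T : C} (a : T ⟶ A.X) (b : T ⟶ B.X) : T ⟶ (prodMon A B).X :=
  lift a b

theorem pairMon_fst {A B : CommMon C} {T : C} (a : T ⟶ A.X) (b : T ⟶ B.X) :
    pairMon a b ≫ toHom (fstMon A B) = a :=
  lift_fst a b

theorem pairMon_snd {A B : CommMon C} {T : C} (a : T ⟶ A.X) (b : T ⟶ B.X) :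
    pairMon a b ≫ toHom (sndMon A B) = b :=
  lift_snd a b

theorem prodMon_ext {A B : CommMon C} {T : C} {p q : T ⟶ (prodMon A B).X}
    (h1 : p ≫ toHom (fstMon A B) = q ≫ toHom (fstMon A B))
    (h2 : p ≫ toHom (sndMon A B) = q ≫ toHom (sndMon A B)) : p = q :=
  CartesianMonoidalCategory.hom_ext (X := A.X) (Y := B.X) p q h1 h2

theorem comp_pairMon {A B : CommMon C} {S T : C} (h : S ⟶ T) (a : T ⟶ A.X) (b : T ⟶ B.X) :
    h ≫ pairMon a b = pairMon (h ≫ a) (h ≫ b) :=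
  comp_lift h a b

theorem pairMon_add {A B : CommMon C} {T : C} (a a' : T ⟶ A.X) (b b' : T ⟶ B.X) :
    pairMon (a + a') (b + b') = pairMon a b + pairMon a' b' := by
  refine prodMon_ext ?_ ?_
  · simp only [add_comp, pairMon_fst]
  · simp only [add_comp, pairMon_snd]

theorem pairMon_zero (A B : CommMon C) (T : C) :
    pairMon (0 : T ⟶ A.X) (0 : T ⟶ B.X) = 0 := by
  refine prodMon_ext ?_ ?_
  · simp only [zero_comp, pairMon_fst]
  · simp only [zero_comp, pairMon_snd]

/-- The addition of a commutative monoid, as an additive map. -/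
def addMon (A : CommMon C) : prodMon A A ⟶ A :=
  mkHom (A := prodMon A A) μ[A.X] (IsMonHom.one_hom (f := μ[A.X]))
    (IsMonHom.mul_hom (f := μ[A.X]))

/-- The unique additive map to the trivial monoid on the terminal object. -/
def toUnitMon (A : CommMon C) : A ⟶ CommMon.trivial C :=
  mkHom (B := CommMon.trivial C) (toUnit A.X) (IsMonHom.one_hom (f := toUnit A.X))
    (IsMonHom.mul_hom (f := toUnit A.X))

/-- The zero of a commutative monoid, as an additive map. -/
def zeroMon (A : CommMon C) : CommMon.trivial C ⟶ A :=
  mkHom (A := CommMon.trivial C) η[A.X] (IsMonHom.one_hom (f := η[A.X]))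
    (IsMonHom.mul_hom (f := η[A.X]))

end

section

variable {C : Type u} [Category.{v} C] [CartesianMonoidalCategory C] [BraidedCategory C]
variable {Z W V U : Faa C}

/-- The object `((A,+,0),A)` of `Faà(C)`, for a commutative monoid `(A,+,0)` in `C`. -/
abbrev Faa.ofMon (A : CommMon C) : Faa C := ⟨A, A.X⟩

/-- The product `((A × B, ex ≫ (+ × +), 0 × 0), X × Y)` of two objects of `Faà(C)`. -/
abbrev Faa.prod (Z W : Faa C) : Faa C := ⟨prodMon Z.mon W.mon, Z.base ⊗ W.base⟩

theorem ev_sum (f : Faa.Hom Z W) {T : C} {n : ℕ} (a : Fin n → (T ⟶ Z.mon.X)) (x : T ⟶ Z.base)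
    (i : Fin n) {κ : Type*} (s : Finset κ) (b : κ → (T ⟶ Z.mon.X)) :
    ev f (Function.update a i (∑ k ∈ s, b k)) x =
      ∑ k ∈ s, ev f (Function.update a i (b k)) x :=
  map_sum (⟨⟨fun b => ev f (Function.update a i b) x,
    ev_zero f _ x i (Function.update_self ..)⟩, ev_add f a x i⟩ :
      (T ⟶ Z.mon.X) →+ (T ⟶ W.mon.X)) b s

/-- The value at generalized elements of the terms of the derivative. -/
def dev (f : Faa.Hom Z W) {T : C} {n : ℕ} (b c : Fin n → (T ⟶ Z.mon.X)) (a : T ⟶ Z.mon.X)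
    (x : T ⟶ Z.base) : T ⟶ W.mon.X :=
  ev f (Fin.cons a c : Fin (n + 1) → (T ⟶ Z.mon.X)) x +
    ∑ i, ev f (Function.update c i (b i)) x

theorem dev_update_add (f : Faa.Hom Z W) {T : C} {n : ℕ} (b c : Fin n → (T ⟶ Z.mon.X))
    (a : T ⟶ Z.mon.X) (x : T ⟶ Z.base) (i : Fin n) (b₁ b₂ c₁ c₂ : T ⟶ Z.mon.X) :
    dev f (Function.update b i (b₁ + b₂)) (Function.update c i (c₁ + c₂)) a x =
      dev f (Function.update b i b₁) (Function.update c i c₁) a x +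
        dev f (Function.update b i b₂) (Function.update c i c₂) a x := by
  simp only [dev]
  rw [add_add_add_comm, ← Finset.sum_add_distrib]
  congr 1
  · simp only [Fin.cons_update, ev_add]
  · refine Finset.sum_congr rfl fun j _ => ?_
    by_cases h : j = i
    · subst h
      simp only [Function.update_self, Function.update_idem, ev_add]
    · simp only [Function.update_of_ne h]
      rw [Function.update_comm (Ne.symm h), Function.update_comm (Ne.symm h),
        Function.update_comm (Ne.symm h), ev_add]

theorem dev_update_zero (f : Faa.Hom Z W) {T : C} {n : ℕ} (b c : Fin n → (T ⟶ Z.mon.X))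
    (a : T ⟶ Z.mon.X) (x : T ⟶ Z.base) (i : Fin n) :
    dev f (Function.update b i 0) (Function.update c i 0) a x = 0 := by
  rw [dev, ev_zero f _ x i.succ (by simp), zero_add]
  refine Finset.sum_eq_zero fun j _ => ev_zero f _ x i ?_
  by_cases h : j = i
  · subst h; simp
  · rw [Function.update_of_ne (Ne.symm h), Function.update_self]

theorem dev_symm (f : Faa.Hom Z W) {T : C} {n : ℕ} (b c : Fin n → (T ⟶ Z.mon.X))
    (a : T ⟶ Z.mon.X) (x : T ⟶ Z.base) (σ : Equiv.Perm (Fin n)) :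
    dev f (fun i => b (σ i)) (fun i => c (σ i)) a x = dev f b c a x := by
  rw [dev, dev]
  congr 1
  · let τ : Equiv.Perm (Fin (n + 1)) := Equiv.Perm.decomposeFin.symm (0, σ)
    rw [← ev_symm f (Fin.cons a c) x τ]
    refine congrArg (fun a => ev f a x) (funext (Fin.cases ?_ fun i => ?_))
    · simp [τ]
    · simp [τ]
  · refine Eq.trans ?_ (Equiv.sum_comp σ fun i => ev f (Function.update c i (b i)) x)
    refine Finset.sum_congr rfl fun i _ => ?_
    refine Eq.trans ?_ (ev_symm f _ x σ)
    refine congrArg (fun a => ev f a x) (funext fun j => ?_)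
    by_cases h : j = i
    · subst h; simp
    · rw [Function.update_of_ne h, Function.update_of_ne (fun h' => h (σ.injective h'))]

theorem dev_add (f : Faa.Hom Z W) {T : C} {n : ℕ} (b b' c : Fin n → (T ⟶ Z.mon.X))
    (a a' : T ⟶ Z.mon.X) (x : T ⟶ Z.base) :
    dev f (fun i => b i + b' i) c (a + a') x = dev f b c a x + dev f b' c a' x := by
  simp only [dev]
  rw [add_add_add_comm, ← Finset.sum_add_distrib]
  congr 1
  · have := ev_add f (Fin.cons a c : Fin (n + 1) → (T ⟶ Z.mon.X)) x 0 a a'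
    simpa only [Fin.update_cons_zero] using this
  · simp only [ev_add]

theorem dev_zero (f : Faa.Hom Z W) {T : C} {n : ℕ} (c : Fin n → (T ⟶ Z.mon.X))
    (x : T ⟶ Z.base) : dev f (fun _ => 0) c 0 x = 0 := by
  rw [dev, ev_zero f _ x 0 (Fin.cons_zero ..), zero_add]
  exact Finset.sum_eq_zero fun i _ => ev_zero f _ x i (Function.update_self ..)

/-- The `(n+1)`-st term of the derivative of `f = (f_*, f₁, f₂, …)`.  At vectors `(bᵢ,cᵢ)`, for
`i < n+1`, and at the point `(a,x)`, its value is
`f_{n+2}(a,c₀,…,cₙ,x) + ∑ᵢ f_{n+1}(c₀,…,bᵢ,…,cₙ,x)`, with `bᵢ` at the place of `cᵢ`. -/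
def derivTerm (f : Faa.Hom Z W) (n : ℕ) :
    pow (prodMon Z.mon Z.mon).X (Z.mon.X ⊗ Z.base) (n + 1) ⟶ W.mon.X :=
  tuple (n + 2)
      (Fin.cons (last (n + 1) ≫ fst Z.mon.X Z.base)
        (fun i => proj i ≫ toHom (sndMon Z.mon Z.mon)))
      (last (n + 1) ≫ snd Z.mon.X Z.base) ≫ f.term (n + 1) +
    ∑ i : Fin (n + 1),
      tuple (n + 1)
        (Function.update (fun j => proj j ≫ toHom (sndMon Z.mon Z.mon)) i
          (proj i ≫ toHom (fstMon Z.mon Z.mon)))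
        (last (n + 1) ≫ snd Z.mon.X Z.base) ≫ f.term n

theorem tuple_derivTerm (f : Faa.Hom Z W) {T : C} {n : ℕ}
    (p : Fin (n + 1) → (T ⟶ (prodMon Z.mon Z.mon).X)) (y : T ⟶ Z.mon.X ⊗ Z.base) :
    tuple (n + 1) p y ≫ derivTerm f n =
      dev f (fun i => p i ≫ toHom (fstMon Z.mon Z.mon)) (fun i => p i ≫ toHom (sndMon Z.mon Z.mon))
        (y ≫ fst Z.mon.X Z.base) (y ≫ snd Z.mon.X Z.base) := by
  rw [derivTerm, comp_add, comp_sum, dev]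
  simp only [← Category.assoc, comp_tuple, tuple_last]
  congr 1
  · refine congrArg (fun a => ev f a (y ≫ snd Z.mon.X Z.base))
      (funext (Fin.cases ?_ fun i => ?_))
    · simp only [Fin.cons_zero, ← Category.assoc, tuple_last]
    · simp only [Fin.cons_succ, ← Category.assoc, tuple_proj]
  · refine Finset.sum_congr rfl fun i _ => ?_
    refine congrArg (fun a => ev f a (y ≫ snd Z.mon.X Z.base)) (funext fun j => ?_)
    by_cases h : j = i
    · subst h
      simp only [Function.update_self, ← Category.assoc, tuple_proj]
    · simp only [Function.update_of_ne h, ← Category.assoc, tuple_proj]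

/-- The derivative `D(f) : ((A × A, …), A × X) ⟶ ((B,+,0), B)` of a morphism
`f = (f_*, f₁, f₂, …) : ((A,+,0),X) ⟶ ((B,+,0),Y)`. -/
def Faa.deriv (f : Faa.Hom Z W) :
    Faa.Hom (Faa.prod (Faa.ofMon Z.mon) Z) (Faa.ofMon W.mon) where
  star := f.term 0
  term n := derivTerm f n
  term_add n T p y i b c := by
    refine (tuple_derivTerm f _ _).trans ?_
    refine Eq.trans ?_ (congrArg₂ (· + ·) (tuple_derivTerm f _ _) (tuple_derivTerm f _ _)).symm
    have h : ∀ (u : prodMon Z.mon Z.mon ⟶ Z.mon) (q : T ⟶ (prodMon Z.mon Z.mon).X),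
        (fun j => (Function.update p i q : Fin (n + 1) → (T ⟶ (prodMon Z.mon Z.mon).X)) j ≫
          toHom u) = Function.update (fun j => p j ≫ toHom u) i (q ≫ toHom u) :=
      fun u q => funext fun j => Function.apply_update (fun _ q => q ≫ toHom u) p i q j
    refine (congrArg₂ (fun s t => dev f s t _ _) (h _ _) (h _ _)).trans ?_
    refine Eq.trans ?_ (congrArg₂ (· + ·)
      (congrArg₂ (fun s t => dev f s t _ _) (h _ _) (h _ _))
      (congrArg₂ (fun s t => dev f s t _ _) (h _ _) (h _ _))).symm
    rw [← dev_update_add]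
    erw [add_comp, add_comp]
  term_zero n T p y i := by
    refine (tuple_derivTerm f _ _).trans ?_
    have h : ∀ (u : prodMon Z.mon Z.mon ⟶ Z.mon) (q : T ⟶ (prodMon Z.mon Z.mon).X),
        (fun j => (Function.update p i q : Fin (n + 1) → (T ⟶ (prodMon Z.mon Z.mon).X)) j ≫
          toHom u) = Function.update (fun j => p j ≫ toHom u) i (q ≫ toHom u) :=
      fun u q => funext fun j => Function.apply_update (fun _ q => q ≫ toHom u) p i q j
    refine (congrArg₂ (fun s t => dev f s t _ _) (h _ _) (h _ _)).trans ?_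
    erw [zero_comp, zero_comp]
    exact dev_update_zero ..
  term_symm n T p y σ := by
    refine (tuple_derivTerm f _ _).trans (Eq.trans ?_ (tuple_derivTerm f _ _).symm)
    exact dev_symm f (fun i => p i ≫ toHom (fstMon Z.mon Z.mon))
      (fun i => p i ≫ toHom (sndMon Z.mon Z.mon)) _ _ σ

theorem ev_deriv (f : Faa.Hom Z W) {T : C} {n : ℕ}
    (b c : Fin (n + 1) → (T ⟶ Z.mon.X)) (a : T ⟶ Z.mon.X) (x : T ⟶ Z.base) :
    ev (Faa.deriv f) (fun i => pairMon (b i) (c i)) (lift a x) = dev f b c a x := by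
  refine (tuple_derivTerm f _ _).trans ?_
  show dev f (fun i => pairMon (b i) (c i) ≫ toHom (fstMon Z.mon Z.mon))
    (fun i => pairMon (b i) (c i) ≫ toHom (sndMon Z.mon Z.mon))
    (lift a x ≫ fst Z.mon.X Z.base) (lift a x ≫ snd Z.mon.X Z.base) = _
  simp only [pairMon_fst, pairMon_snd, lift_fst, lift_snd]

theorem star_deriv (f : Faa.Hom Z W) {T : C} (a : T ⟶ Z.mon.X) (x : T ⟶ Z.base) :
    lift a x ≫ (Faa.deriv f).star = ev f (fun _ : Fin 1 => a) x := rfl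

theorem compFun_modify (f : Faa.Hom Z W) (g : Faa.Hom W V) {T : C} {n : ℕ}
    (c : OrderedFinpartition n) (a : Fin n → (T ⟶ Z.mon.X)) (x : T ⟶ Z.base) (y : T ⟶ W.base)
    (b : T ⟶ Z.mon.X) (m : Fin c.length) :
    compFun f g x y ((blocks c a).modify m fun q => b :: q) =
      ev g (Function.update (fun m => ev f (fun j => a (c.emb m j)) x) m
        (ev f (Fin.cons b (fun j => a (c.emb m j)) : Fin (_ + 1) → (T ⟶ Z.mon.X)) x)) y := by
  rw [compFun, ← evL_ofFn g]
  congr 1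
  refine List.ext_getElem (by simp [blocks]) fun i h1 h2 => ?_
  have hi : i < c.length := by simpa [blocks] using h1
  rw [List.getElem_map, List.getElem_modify, List.getElem_ofFn]
  by_cases h : (m : ℕ) = i
  · obtain rfl : m = ⟨i, hi⟩ := Fin.ext h
    rw [if_pos h, Function.update_self, ← evL_ofFn f]
    simp [blocks, List.ofFn_succ]
  · have h' : (⟨i, hi⟩ : Fin c.length) ≠ m := fun h' => h (congrArg Fin.val h').symm
    rw [if_neg h, Function.update_of_ne h', ← evL_ofFn f]
    simp [blocks]

theorem ev_comp_cons (f : Faa.Hom Z W) (g : Faa.Hom W V) {T : C} {n : ℕ}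
    (a : T ⟶ Z.mon.X) (c : Fin n → (T ⟶ Z.mon.X)) (x : T ⟶ Z.base) :
    ev (Faa.comp Z W V f g) (Fin.cons a c : Fin (n + 1) → (T ⟶ Z.mon.X)) x =
      ∑ π : OrderedFinpartition n,
        (ev g (Fin.cons (ev f (fun _ : Fin 1 => a) x)
            (fun m => ev f (fun j => c (π.emb m j)) x) : Fin (_ + 1) → (T ⟶ W.mon.X))
            (x ≫ f.star) +
          ∑ m, ev g (Function.update (fun m => ev f (fun j => c (π.emb m j)) x) m
            (ev f (Fin.cons a (fun j => c (π.emb m j)) : Fin (_ + 1) → (T ⟶ Z.mon.X)) x))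
            (x ≫ f.star)) := by
  rw [ev_comp', List.ofFn_succ, sumParts]
  simp only [Fin.cons_zero, Fin.cons_succ]
  rw [← sum_partitions]
  refine Finset.sum_congr rfl fun π _ => ?_
  rw [ins]
  congr 1
  · rw [compFun, List.map_cons, ← evL_ofFn g, List.ofFn_succ]
    simp only [Fin.cons_zero, Fin.cons_succ, blocks, List.map_ofFn]
    congr 2
    refine congrArg List.ofFn (funext fun m => ?_)
    exact evL_ofFn f _ x
  · have : (blocks π c).length = π.length := by simp [blocks]
    rw [this, Finset.sum_range]
    exact Finset.sum_congr rfl fun m _ => compFun_modify f g π c x _ a m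

theorem dev_comp (f : Faa.Hom Z W) (g : Faa.Hom W V) {T : C} {n : ℕ}
    (b c : Fin n → (T ⟶ Z.mon.X)) (a : T ⟶ Z.mon.X) (x : T ⟶ Z.base) :
    dev (Faa.comp Z W V f g) b c a x =
      ∑ π : OrderedFinpartition n,
        dev g (fun m => dev f (fun j => b (π.emb m j)) (fun j => c (π.emb m j)) a x)
          (fun m => ev f (fun j => c (π.emb m j)) x) (ev f (fun _ : Fin 1 => a) x)
          (x ≫ f.star) := by
  rw [dev, ev_comp_cons]
  simp only [ev_comp]
  rw [Finset.sum_comm, ← Finset.sum_add_distrib]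
  refine Finset.sum_congr rfl fun π _ => ?_
  rw [add_assoc, dev]
  congr 1
  rw [← π.equivSigma.sum_comp, Fintype.sum_sigma, ← Finset.sum_add_distrib]
  refine Finset.sum_congr rfl fun m _ => ?_
  rw [dev, ev_add, ev_sum]
  congr 1
  refine Finset.sum_congr rfl fun r _ => ?_
  exact congrArg (fun a => ev g a (x ≫ f.star)) (block_update π c (fun a => ev f a x) m r _)

end

section

variable {C : Type u} [Category.{v} C] [CartesianMonoidalCategory C] [BraidedCategory C]
variable {Z W V U : Faa C}

theorem ev_comp_one (f : Faa.Hom Z W) (g : Faa.Hom W V) {T : C} (a : T ⟶ Z.mon.X)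
    (x : T ⟶ Z.base) : ev (Faa.comp Z W V f g) (fun _ : Fin 1 => a) x =
      ev g (fun _ : Fin 1 => ev f (fun _ : Fin 1 => a) x) (x ≫ f.star) := by
  rw [ev_comp, Fintype.sum_unique]
  rfl

theorem ev_deriv_pos (f : Faa.Hom Z W) {T : C} {n : ℕ} (hn : 0 < n)
    (b c : Fin n → (T ⟶ Z.mon.X)) (a : T ⟶ Z.mon.X) (x : T ⟶ Z.base) :
    ev (Faa.deriv f) (fun i => pairMon (b i) (c i)) (lift a x) = dev f b c a x := by
  obtain ⟨n, rfl⟩ := Nat.exists_eq_succ_of_ne_zero hn.ne'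
  exact ev_deriv f b c a x

theorem dev_zero_left (f : Faa.Hom Z W) {T : C} {n : ℕ} (c : Fin n → (T ⟶ Z.mon.X))
    (a : T ⟶ Z.mon.X) (x : T ⟶ Z.base) :
    dev f (fun _ => 0) c a x = ev f (Fin.cons a c : Fin (n + 1) → (T ⟶ Z.mon.X)) x := by
  rw [dev, Finset.sum_eq_zero, add_zero]
  exact fun i _ => ev_zero f _ x i (Function.update_self ..)

/-- The pairing `⟨f,g⟩ = (⟨f_*,g_*⟩, ⟨f₁,g₁⟩, …)`. -/
def Faa.pair (f : Faa.Hom U Z) (g : Faa.Hom U W) : Faa.Hom U (Faa.prod Z W) where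
  star := lift f.star g.star
  term n := pairMon (f.term n) (g.term n)
  term_add n T a x i b c := by
    erw [comp_pairMon, comp_pairMon, comp_pairMon, f.term_add, g.term_add, pairMon_add]
  term_zero n T a x i := by
    erw [comp_pairMon, f.term_zero, g.term_zero, pairMon_zero]
  term_symm n T a x σ := by
    erw [comp_pairMon, comp_pairMon, f.term_symm, g.term_symm]

theorem ev_pair (f : Faa.Hom U Z) (g : Faa.Hom U W) {T : C} {n : ℕ}
    (a : Fin n → (T ⟶ U.mon.X)) (x : T ⟶ U.base) :
    ev (Faa.pair f g) a x = pairMon (ev f a x) (ev g a x) := by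
  cases n with
  | zero =>
    rw [ev_empty, ev_empty, ev_empty]
    exact (pairMon_zero _ _ _).symm
  | succ n => exact comp_pairMon _ _ _

theorem pairMon_sum {A B : CommMon C} {T : C} {κ : Type*} (s : Finset κ) (a : κ → (T ⟶ A.X))
    (b : κ → (T ⟶ B.X)) :
    pairMon (∑ k ∈ s, a k) (∑ k ∈ s, b k) = ∑ k ∈ s, pairMon (a k) (b k) := by
  classical
  induction s using Finset.induction_on with
  | empty => exact pairMon_zero _ _ _
  | insert k s hk ih => rw [Finset.sum_insert hk, Finset.sum_insert hk, Finset.sum_insert hk,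
      pairMon_add, ih]

/-- The projections `(π, π₀π, 0, 0, …)` of a product in `Faà(C)`. -/
def Faa.fst (Z W : Faa C) : Faa.Hom (Faa.prod Z W) Z :=
  Faa.lin (Z := Faa.prod Z W) (fstMon Z.mon W.mon) (CartesianMonoidalCategory.fst Z.base W.base)

def Faa.snd (Z W : Faa C) : Faa.Hom (Faa.prod Z W) W :=
  Faa.lin (Z := Faa.prod Z W) (sndMon Z.mon W.mon) (CartesianMonoidalCategory.snd Z.base W.base)

theorem comp_pair (h : Faa.Hom V U) (f : Faa.Hom U Z) (g : Faa.Hom U W) :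
    Faa.comp _ _ _ h (Faa.pair f g) = Faa.pair (Faa.comp _ _ _ h f) (Faa.comp _ _ _ h g) := by
  refine hom_ext' (comp_lift _ _ _) fun n T a x => ?_
  rw [ev_comp, ev_pair, ev_comp, ev_comp]
  refine Eq.trans ?_ (pairMon_sum _ _ _).symm
  exact Finset.sum_congr rfl fun c _ => ev_pair _ _ _ _

theorem lin_assoc (u : Z.mon ⟶ W.mon) (v : Z.base ⟶ W.base) (f : Faa.Hom W V)
    (g : Faa.Hom V U) :
    Faa.comp _ _ _ (Faa.comp _ _ _ (Faa.lin u v) f) g =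
      Faa.comp _ _ _ (Faa.lin u v) (Faa.comp _ _ _ f g) := by
  refine hom_ext' (Category.assoc _ _ _) fun n T a x => ?_
  rw [ev_lin_comp, ev_comp, ev_comp]
  refine Finset.sum_congr rfl fun c _ => ?_
  simp only [ev_lin_comp]
  refine congrArg (fun y => ev g _ y) (Category.assoc _ _ _).symm

theorem mid_assoc (f : Faa.Hom Z W) (u : W.mon ⟶ V.mon) (v : W.base ⟶ V.base)
    (g : Faa.Hom V U) :
    Faa.comp _ _ _ (Faa.comp _ _ _ f (Faa.lin u v)) g =
      Faa.comp _ _ _ f (Faa.comp _ _ _ (Faa.lin u v) g) := by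
  refine hom_ext' (Category.assoc _ _ _) fun n T a x => ?_
  rw [ev_comp, ev_comp]
  refine Finset.sum_congr rfl fun c _ => ?_
  simp only [ev_lin_comp, ev_comp_lin]
  refine congrArg (fun y => ev g _ y) (Category.assoc _ _ _).symm

theorem pair_fst (f : Faa.Hom U Z) (g : Faa.Hom U W) :
    Faa.comp _ _ _ (Faa.pair f g) (Faa.fst Z W) = f := by
  refine hom_ext' (lift_fst _ _) fun n T a x => ?_
  refine (ev_comp_lin _ _ _ _ _).trans ?_
  rw [ev_pair]
  exact pairMon_fst _ _

theorem pair_snd (f : Faa.Hom U Z) (g : Faa.Hom U W) :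
    Faa.comp _ _ _ (Faa.pair f g) (Faa.snd Z W) = g := by
  refine hom_ext' (lift_snd _ _) fun n T a x => ?_
  refine (ev_comp_lin _ _ _ _ _).trans ?_
  rw [ev_pair]
  exact pairMon_snd _ _

theorem pair_ext {f g : Faa.Hom U (Faa.prod Z W)}
    (h1 : Faa.comp _ _ _ f (Faa.fst Z W) = Faa.comp _ _ _ g (Faa.fst Z W))
    (h2 : Faa.comp _ _ _ f (Faa.snd Z W) = Faa.comp _ _ _ g (Faa.snd Z W)) : f = g := by
  refine hom_ext' (CartesianMonoidalCategory.hom_ext _ _ (congrArg Faa.Hom.star h1)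
    (congrArg Faa.Hom.star h2)) fun n T a x => ?_
  refine prodMon_ext ?_ ?_
  · exact (ev_comp_lin f _ _ _ _).symm.trans
      ((congrArg (fun f => ev f a x) h1).trans (ev_comp_lin g _ _ _ _))
  · exact (ev_comp_lin f _ _ _ _).symm.trans
      ((congrArg (fun f => ev f a x) h2).trans (ev_comp_lin g _ _ _ _))

/-- Decomposition of points and vectors of `((A × A, …), A × X)`. -/
theorem deriv_ext {f g : Faa.Hom (Faa.prod (Faa.ofMon Z.mon) Z) W}
    (h0 : ∀ {T : C} (a : T ⟶ Z.mon.X) (x : T ⟶ Z.base),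
      lift a x ≫ f.star = lift a x ≫ g.star)
    (h : ∀ (n : ℕ) {T : C} (b c : Fin (n + 1) → (T ⟶ Z.mon.X)) (a : T ⟶ Z.mon.X)
      (x : T ⟶ Z.base), ev f (fun i => pairMon (b i) (c i)) (lift a x) =
        ev g (fun i => pairMon (b i) (c i)) (lift a x)) : f = g := by
  refine hom_ext' ?_ fun n T p y => ?_
  · have := h0 (CartesianMonoidalCategory.fst Z.mon.X Z.base)
      (CartesianMonoidalCategory.snd Z.mon.X Z.base)
    rw [lift_fst_snd] at this
    exact (Category.id_comp _).symm.trans (this.trans (Category.id_comp _))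
  · have := h n (fun i => p i ≫ toHom (fstMon Z.mon Z.mon))
      (fun i => p i ≫ toHom (sndMon Z.mon Z.mon))
      (y ≫ CartesianMonoidalCategory.fst Z.mon.X Z.base)
      (y ≫ CartesianMonoidalCategory.snd Z.mon.X Z.base)
    have h1 : lift (y ≫ CartesianMonoidalCategory.fst Z.mon.X Z.base)
      (y ≫ CartesianMonoidalCategory.snd Z.mon.X Z.base) = y := lift_comp_fst_snd _
    have h2 : ∀ i, pairMon (p i ≫ toHom (fstMon Z.mon Z.mon))
      (p i ≫ toHom (sndMon Z.mon Z.mon)) = p i := fun i => lift_comp_fst_snd _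
    exact (congrArg₂ (fun p y => ev f p y) (funext h2) h1).symm.trans
      (this.trans (congrArg₂ (fun p y => ev g p y) (funext h2) h1))

/-- The chain rule. -/
theorem deriv_comp (f : Faa.Hom Z W) (g : Faa.Hom W V) :
    Faa.deriv (Faa.comp _ _ _ f g) =
      Faa.comp _ _ _ (Faa.pair (Faa.deriv f)
        (Faa.comp _ _ _ (Faa.snd (Faa.ofMon Z.mon) Z) f)) (Faa.deriv g) := by
  refine deriv_ext (fun a x => ?_) fun n T b c a x => ?_
  · rw [star_deriv, ev_comp_one]
    refine Eq.trans ?_ (Category.assoc _ _ _)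
    erw [comp_lift]
    refine (star_deriv g _ _).symm.trans ?_
    congr 2
    exact (lift_snd_assoc _ _ _).symm
  · rw [ev_deriv, dev_comp]
    refine Eq.trans ?_ (ev_comp _ _ _ _).symm
    refine Finset.sum_congr rfl fun π _ => ?_
    refine (ev_deriv_pos g (π.length_pos n.succ_pos) _ _ _ _).symm.trans ?_
    have h1 : (fun m => pairMon (dev f (fun j => b (π.emb m j)) (fun j => c (π.emb m j)) a x)
        (ev f (fun j => c (π.emb m j)) x)) = fun m => ev (Faa.pair (Faa.deriv f)
          (Faa.comp _ _ _ (Faa.snd (Faa.ofMon Z.mon) Z) f))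
          (fun j => pairMon (b (π.emb m j)) (c (π.emb m j))) (lift a x) := by
      funext m
      refine Eq.trans ?_ (ev_pair (Faa.deriv f)
        (Faa.comp _ _ _ (Faa.snd (Faa.ofMon Z.mon) Z) f)
        (fun j => pairMon (b (π.emb m j)) (c (π.emb m j))) (lift a x)).symm
      refine congrArg₂ pairMon (ev_deriv_pos f (π.partSize_pos m) _ _ _ _).symm ?_
      refine Eq.trans ?_ (ev_lin_comp _ _ _ _ _).symm
      refine congrArg₂ (fun a x => ev f a x) (funext fun j => (pairMon_snd _ _).symm)
        (lift_snd _ _).symm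
    have h2 : lift (ev f (fun _ : Fin 1 => a) x) (x ≫ f.star) =
        lift a x ≫ (Faa.pair (Faa.deriv f)
          (Faa.comp _ _ _ (Faa.snd (Faa.ofMon Z.mon) Z) f)).star := by
      refine Eq.trans ?_ (comp_lift _ _ _).symm
      refine congrArg₂ lift (star_deriv f a x).symm (lift_snd_assoc _ _ _).symm
    exact congrArg₂ (fun a x => ev (Faa.deriv g) a x) h1 h2

theorem ev_assoc : ∀ (n : ℕ) {Z W V U : Faa C} (f : Faa.Hom Z W) (g : Faa.Hom W V)
    (h : Faa.Hom V U) {T : C} (a : Fin n → (T ⟶ Z.mon.X)) (x : T ⟶ Z.base),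
    ev (Faa.comp _ _ _ (Faa.comp _ _ _ f g) h) a x =
      ev (Faa.comp _ _ _ f (Faa.comp _ _ _ g h)) a x
  | 0, _, _, _, _, _, _, _, _, _, _ => by rw [ev_empty, ev_empty]
  | 1, Z, W, V, U, f, g, h, T, a, x => by
    have ha : a = fun _ => a 0 := funext fun i => by rw [Fin.fin_one_eq_zero i]
    rw [ha, ev_comp_one, ev_comp_one, ev_comp_one, ev_comp_one]
    exact congrArg (fun y => ev h _ y) (Category.assoc _ _ _).symm
  | n + 2, Z, W, V, U, f, g, h, T, a, x => by
    obtain ⟨a, c, rfl⟩ : ∃ b c, a = Fin.cons b c := ⟨a 0, Fin.tail a, (Fin.cons_self_tail a).symm⟩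
    rw [← dev_zero_left, ← dev_zero_left, ← ev_deriv, ← ev_deriv,
      deriv_comp (Faa.comp _ _ _ f g) h, deriv_comp f (Faa.comp _ _ _ g h), deriv_comp f g, deriv_comp g h]
    have key : Faa.pair (Faa.comp _ _ _ (Faa.pair (Faa.deriv f)
        (Faa.comp _ _ _ (Faa.snd (Faa.ofMon Z.mon) Z) f)) (Faa.deriv g))
        (Faa.comp _ _ _ (Faa.snd (Faa.ofMon Z.mon) Z) (Faa.comp _ _ _ f g)) =
        Faa.comp _ _ _ (Faa.pair (Faa.deriv f)
          (Faa.comp _ _ _ (Faa.snd (Faa.ofMon Z.mon) Z) f))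
          (Faa.pair (Faa.deriv g) (Faa.comp _ _ _ (Faa.snd (Faa.ofMon W.mon) W) g)) := by
      rw [comp_pair]
      congr 1
      refine (lin_assoc _ _ f g).symm.trans ?_
      refine Eq.trans ?_ (mid_assoc _ _ _ g)
      exact congrArg (fun f => Faa.comp _ _ _ f g) (pair_snd _ _).symm
    rw [key]
    exact ev_assoc (n + 1) _ _ _ _ _

noncomputable instance : Category (Faa C) where
  Hom := Faa.Hom
  id Z := Faa.lin (𝟙 Z.mon) (𝟙 Z.base)
  comp f g := Faa.comp _ _ _ f g
  id_comp f := hom_ext' (Category.id_comp _) fun n T a x => by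
    refine (ev_lin_comp _ _ _ _ _).trans ?_
    refine congrArg₂ (fun a x => ev f a x) (funext fun i => Category.comp_id _)
      (Category.comp_id _)
  comp_id f := hom_ext' (Category.comp_id _) fun n T a x => by
    refine (ev_comp_lin _ _ _ _ _).trans (Category.comp_id _)
  assoc f g h := hom_ext' (Category.assoc _ _ _) fun n T a x => ev_assoc _ f g h a x

end

section

section General

variable {X : Type u} [Category.{v} X] [CartesianMonoidalCategory X] [BraidedCategory X]

/-- A commutative monoid, from the laws on generalized elements. -/
def mkCommMon (A : X) (z : 𝟙_ X ⟶ A) (m : A ⊗ A ⟶ A)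
    (hz : ∀ {T : X} (p : T ⟶ A), lift (toUnit T ≫ z) p ≫ m = p)
    (hc : ∀ {T : X} (p q : T ⟶ A), lift p q ≫ m = lift q p ≫ m)
    (ha : ∀ {T : X} (p q r : T ⟶ A),
      lift (lift p q ≫ m) r ≫ m = lift p (lift q r ≫ m) ≫ m) : CommMon X :=
  letI M : MonObj A :=
    { one := z
      mul := m
      one_mul := by
        rw [leftUnitor_hom, ← hz (snd (𝟙_ X) A)]
        congr 1
        ext
        · rw [whiskerRight_fst, lift_fst]
          congr 1
          exact toUnit_unique _ _
        · rw [whiskerRight_snd, lift_snd]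
      mul_one := by
        rw [rightUnitor_hom, ← hz (fst A (𝟙_ X)), hc]
        congr 1
        ext
        · rw [whiskerLeft_fst, lift_fst]
        · rw [whiskerLeft_snd, lift_snd]
          congr 1
          exact toUnit_unique _ _
      mul_assoc := by
        have h := ha (fst (A ⊗ A) A ≫ fst A A) (fst (A ⊗ A) A ≫ snd A A) (snd (A ⊗ A) A)
        have h1 : m ▷ A = lift (lift (fst (A ⊗ A) A ≫ fst A A) (fst (A ⊗ A) A ≫ snd A A) ≫ m)
            (snd (A ⊗ A) A) := by
          ext
          · rw [whiskerRight_fst, lift_fst, lift_comp_fst_snd]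
          · rw [whiskerRight_snd, lift_snd]
        have h2 : (α_ A A A).hom ≫ A ◁ m = lift (fst (A ⊗ A) A ≫ fst A A)
            (lift (fst (A ⊗ A) A ≫ snd A A) (snd (A ⊗ A) A) ≫ m) := by
          ext
          · rw [Category.assoc, whiskerLeft_fst, lift_fst, associator_hom_fst]
          · rw [Category.assoc, whiskerLeft_snd, lift_snd, ← Category.assoc]
            congr 1
            ext <;> simp
        rw [h1, h, ← h2, Category.assoc] }
  haveI : IsCommMonObj A :=
    { mul_comm := by
        show (β_ A A).hom ≫ m = m
        rw [← lift_snd_fst, ← hc, lift_fst_snd, Category.id_comp] }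
  { X := A }

variable (X) in
/-- An assignment of a commutative monoid `L(Z) = (L₀(Z),+,0)` to every object `Z` of a Cartesian
category, with `L(L₀(Z)) = L(Z)` and `L(Z × W) = L(Z) × L(W)`. -/
class VectorStructure where
  L : X → CommMon X
  L_L (Z : X) : L (L Z).X = L Z
  L_prod (Z W : X) : L (Z ⊗ W) = prodMon (L Z) (L W)

open VectorStructure

/-- The object of vectors of `Z`. -/
abbrev L₀ [VectorStructure X] (Z : X) : X := (L Z).X

theorem L₀_L₀ [VectorStructure X] (Z : X) : L₀ (L₀ Z) = L₀ Z :=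
  congrArg CommMon.X (L_L Z)

theorem L₀_prod [VectorStructure X] (Z W : X) : L₀ (Z ⊗ W) = L₀ Z ⊗ L₀ W :=
  congrArg CommMon.X (L_prod Z W)

variable (X) in
/-- A generalized Cartesian differential category.  The maps `eqToHom _` are the identities that
come from the equations `L(L₀(Z)) = L(Z)` and `L(Z × W) = L(Z) × L(W)`. -/
class GenCartDiffCat extends VectorStructure X where
  /-- The derivative. -/
  D {Z W : X} (f : Z ⟶ W) : L₀ Z ⊗ Z ⟶ L₀ W
  D_add (Z : X) : D μ[L₀ Z] =
    fst _ _ ≫ eqToHom (by rw [L₀_prod, L₀_L₀]) ≫ μ[L₀ Z] ≫ eqToHom (L₀_L₀ Z).symm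
  D_zero (Z : X) : D η[L₀ Z] = fst _ _ ≫ toUnit _ ≫ η[L₀ Z] ≫ eqToHom (L₀_L₀ Z).symm
  add_D {T Z W : X} (f : Z ⟶ W) (a b : T ⟶ L₀ Z) (c : T ⟶ Z) :
    lift (a + b) c ≫ D f = lift a c ≫ D f + lift b c ≫ D f
  zero_D {T Z W : X} (f : Z ⟶ W) (c : T ⟶ Z) : lift (0 : T ⟶ L₀ Z) c ≫ D f = 0
  D_fst (Z W : X) : D (fst Z W) = fst _ _ ≫ eqToHom (L₀_prod Z W) ≫ fst _ _
  D_snd (Z W : X) : D (snd Z W) = fst _ _ ≫ eqToHom (L₀_prod Z W) ≫ snd _ _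
  D_lift {T Z W : X} (f : T ⟶ Z) (g : T ⟶ W) :
    D (lift f g) = lift (D f) (D g) ≫ eqToHom (L₀_prod Z W).symm
  D_comp {Z W V : X} (f : Z ⟶ W) (g : W ⟶ V) :
    D (f ≫ g) = lift (D f) (snd _ _ ≫ f) ≫ D g
  D_D_linear {T Z W : X} (f : Z ⟶ W) (a c : T ⟶ L₀ Z) (d : T ⟶ Z) :
    lift (lift a (0 : T ⟶ L₀ Z) ≫ eqToHom (by rw [L₀_prod, L₀_L₀])) (lift c d) ≫ D (D f) =
      lift a d ≫ D f ≫ eqToHom (L₀_L₀ W).symm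
  D_D_symm {T Z W : X} (f : Z ⟶ W) (b c : T ⟶ L₀ Z) (d : T ⟶ Z) :
    lift (lift (0 : T ⟶ L₀ Z) b ≫ eqToHom (by rw [L₀_prod, L₀_L₀])) (lift c d) ≫ D (D f) =
      lift (lift (0 : T ⟶ L₀ Z) c ≫ eqToHom (by rw [L₀_prod, L₀_L₀])) (lift b d) ≫ D (D f)

open GenCartDiffCat

/-- A linear object: `L₀(Z) = Z`. -/
def IsLinearObj [GenCartDiffCat X] (Z : X) : Prop := L₀ Z = Z

/-- A linear map: a map `f : Z ⟶ W` between linear objects with `D(f) = π₀f`. -/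
def IsLinearMap [GenCartDiffCat X] {Z W : X} (f : Z ⟶ W) : Prop :=
  ∃ (hZ : L₀ Z = Z) (hW : L₀ W = W), D f = fst _ _ ≫ eqToHom hZ ≫ f ≫ eqToHom hW.symm

end General

variable {C : Type u} [Category.{v} C] [CartesianMonoidalCategory C] [BraidedCategory C]
variable {Z W V U : Faa C}

/-- The terminal object of `Faà(C)`. -/
def Faa.unit (C : Type u) [Category.{v} C] [CartesianMonoidalCategory C] [BraidedCategory C] :
    Faa C := ⟨CommMon.trivial C, 𝟙_ C⟩

noncomputable def Faa.unitLimit : Limits.IsTerminal (Faa.unit C) :=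
  Limits.IsTerminal.ofUniqueHom
    (fun Z => (Faa.lin (W := Faa.unit C) (toUnitMon Z.mon) (toUnit Z.base) : Faa.Hom Z _))
    (fun Z f => Faa.Hom.ext (toUnit_unique _ _) (funext fun n => toUnit_unique (C := C) _ _))

noncomputable def Faa.prodLimit (Z W : Faa C) :
    Limits.IsLimit (Limits.BinaryFan.mk (P := Faa.prod Z W) (Faa.fst Z W : _ ⟶ Z)
      (Faa.snd Z W : _ ⟶ W)) :=
  Limits.BinaryFan.IsLimit.mk _ (fun f g => Faa.pair f g) (fun f g => pair_fst f g)
    (fun f g => pair_snd f g)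
    (fun f g m h1 h2 => pair_ext (h1.trans (pair_fst f g).symm) (h2.trans (pair_snd f g).symm))

noncomputable instance : CartesianMonoidalCategory (Faa C) :=
  CartesianMonoidalCategory.ofChosenFiniteProducts
    ⟨_, Faa.unitLimit⟩ (fun Z W => ⟨_, Faa.prodLimit Z W⟩)

noncomputable instance : BraidedCategory (Faa C) := .ofCartesianMonoidalCategory

theorem faa_lift (f : U ⟶ Z) (g : U ⟶ W) : lift f g = Faa.pair f g := by
  refine CartesianMonoidalCategory.hom_ext _ _ ?_ ?_
  · rw [lift_fst]; exact (pair_fst f g).symm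
  · rw [lift_snd]; exact (pair_snd f g).symm

end

section

variable {C : Type u} [Category.{v} C] [CartesianMonoidalCategory C] [BraidedCategory C]
variable {Z W V U : Faa C}

theorem faa_ext {f g : Z ⟶ W}
    (h : ∀ {T : C} (x : T ⟶ Z.base), x ≫ f.star = x ≫ g.star)
    (h' : ∀ (n : ℕ) {T : C} (a : Fin (n + 1) → (T ⟶ Z.mon.X)) (x : T ⟶ Z.base),
      ev f a x = ev g a x) : f = g := by
  refine hom_ext' ?_ h'
  simpa using h (𝟙 _)

theorem star_lift (f : U ⟶ Z) (g : U ⟶ W) {T : C} (x : T ⟶ U.base) :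
    x ≫ Faa.Hom.star (lift f g) = lift (x ≫ f.star) (x ≫ g.star) := by
  rw [faa_lift]
  exact comp_lift _ _ _

theorem ev_lift (f : U ⟶ Z) (g : U ⟶ W) {T : C} {n : ℕ} (a : Fin n → (T ⟶ U.mon.X))
    (x : T ⟶ U.base) : ev (Z := U) (W := Faa.prod Z W) (lift f g) a x =
      pairMon (ev f a x) (ev g a x) := by
  rw [faa_lift]
  exact ev_pair f g a x

variable (C) in
/-- The functor `λ`, sending `(A,+,0)` to `((A,+,0),A)` and an additive map `f` to
`(f, π₀f, 0, 0, …)`. -/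
noncomputable def lam : CommMon C ⥤ Faa C where
  obj A := Faa.ofMon A
  map {A B} u := (Faa.lin (Z := Faa.ofMon A) (W := Faa.ofMon B) u (toHom u) : Faa.Hom _ _)
  map_id A := rfl
  map_comp {A B D} u v := by
    refine hom_ext' rfl fun n T a x => ?_
    refine Eq.trans ?_ (ev_lin_comp (Z := Faa.ofMon A) (W := Faa.ofMon B) (V := Faa.ofMon D)
      u (toHom u) _ a x).symm
    match n, a with
    | 0, a =>
      rw [ev_lin_one, ev_lin_one, toHom_comp, Category.assoc]
    | n + 1, a => rw [ev_lin_succ, ev_lin_succ]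

noncomputable def faaZero (A : CommMon C) : 𝟙_ (Faa C) ⟶ Faa.ofMon A :=
  (lam C).map (zeroMon A)

noncomputable def faaAdd (A : CommMon C) : Faa.ofMon A ⊗ Faa.ofMon A ⟶ Faa.ofMon A :=
  (lam C).map (addMon A)

theorem ev_faaAdd {A : CommMon C} (p q : U ⟶ Faa.ofMon A) {T : C} {n : ℕ}
    (a : Fin n → (T ⟶ U.mon.X)) (x : T ⟶ U.base) :
    ev (Z := U) (W := Faa.ofMon A) (lift p q ≫ faaAdd A) a x =
      (ev p a x : T ⟶ A.X) + (ev q a x : T ⟶ A.X) := by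
  refine (ev_comp_lin (W := Faa.prod (Faa.ofMon A) (Faa.ofMon A)) (V := Faa.ofMon A)
    (lift p q) (addMon A) μ[A.X] a x).trans ?_
  rw [ev_lift]
  rfl

theorem star_faaAdd {A : CommMon C} (p q : U ⟶ Faa.ofMon A) {T : C} (x : T ⟶ U.base) :
    x ≫ Faa.Hom.star (lift p q ≫ faaAdd A) =
      ((x ≫ p.star : T ⟶ A.X) + (x ≫ q.star : T ⟶ A.X) : T ⟶ A.X) := by
  refine (Category.assoc _ _ _).symm.trans ?_
  rw [star_lift]
  rfl

theorem ev_faaZero {A : CommMon C} {T : C} {n : ℕ}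
    (a : Fin n → (T ⟶ U.mon.X)) (x : T ⟶ U.base) :
    ev (Z := U) (W := Faa.ofMon A) (toUnit U ≫ faaZero A) a x = (0 : T ⟶ A.X) := by
  refine (ev_comp_lin (W := Faa.unit C) (V := Faa.ofMon A)
    (toUnit U) (zeroMon A) η[A.X] a x).trans ?_
  exact congrArg (· ≫ η[A.X]) (toUnit_unique (C := C) _ _)

theorem star_faaZero {A : CommMon C} {T : C} (x : T ⟶ U.base) :
    x ≫ Faa.Hom.star (toUnit U ≫ faaZero A) = (0 : T ⟶ A.X) := by
  refine (Category.assoc _ _ _).symm.trans ?_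
  exact congrArg (· ≫ η[A.X]) (toUnit_unique (C := C) _ _)

/-- The commutative monoid `(((A,+,0),A), (+,π₀+,0,…), (0,π₀0,0,…))` in `Faà(C)`. -/
noncomputable def faaMon (A : CommMon C) : CommMon (Faa C) :=
  mkCommMon (Faa.ofMon A) (faaZero A) (faaAdd A)
    (fun p => faa_ext (fun x => by rw [star_faaAdd, star_faaZero]; exact zero_add _)
      (fun n T a x => by rw [ev_faaAdd, ev_faaZero]; exact zero_add _))
    (fun p q => faa_ext (fun x => by rw [star_faaAdd, star_faaAdd]; exact add_comm _ _)
      (fun n T a x => by rw [ev_faaAdd, ev_faaAdd]; exact add_comm _ _))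
    (fun p q r => faa_ext
      (fun x => by
        rw [star_faaAdd, star_faaAdd, star_faaAdd, star_faaAdd]; exact add_assoc _ _ _)
      (fun n T a x => by
        rw [ev_faaAdd, ev_faaAdd, ev_faaAdd, ev_faaAdd]; exact add_assoc _ _ _))

theorem ev_add_hom {A : CommMon C} (p q : U ⟶ (faaMon A).X) {T : C} {n : ℕ}
    (a : Fin n → (T ⟶ U.mon.X)) (x : T ⟶ U.base) :
    ev (Z := U) (W := Faa.ofMon A) (p + q) a x = (ev p a x : T ⟶ A.X) + (ev q a x : T ⟶ A.X) :=
  ev_faaAdd p q a x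

theorem star_add_hom {A : CommMon C} (p q : U ⟶ (faaMon A).X) {T : C} (x : T ⟶ U.base) :
    x ≫ Faa.Hom.star (p + q) = ((x ≫ p.star : T ⟶ A.X) + (x ≫ q.star : T ⟶ A.X) : T ⟶ A.X) :=
  star_faaAdd p q x

theorem ev_zero_hom {A : CommMon C} {T : C} {n : ℕ}
    (a : Fin n → (T ⟶ U.mon.X)) (x : T ⟶ U.base) :
    ev (Z := U) (W := Faa.ofMon A) (0 : U ⟶ (faaMon A).X) a x = (0 : T ⟶ A.X) :=
  ev_faaZero a x

theorem star_zero_hom {A : CommMon C} {T : C} (x : T ⟶ U.base) :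
    x ≫ Faa.Hom.star (0 : U ⟶ (faaMon A).X) = (0 : T ⟶ A.X) :=
  star_faaZero x

theorem commMon_ext {X : Type u} [Category.{v} X] [CartesianMonoidalCategory X]
    [BraidedCategory X] {A : X} {M N : MonObj A} {hM : @IsCommMonObj X _ _ _ A M}
    {hN : @IsCommMonObj X _ _ _ A N} (h1 : M.one = N.one) (h2 : M.mul = N.mul) :
    (@CommMon.mk X _ _ _ A M hM) = (@CommMon.mk X _ _ _ A N hN) := by
  obtain rfl : M = N := by
    cases M; cases N
    subst h1 h2
    rfl
  rfl

theorem faaAdd_lam {A B : CommMon C} (u : A ⟶ B) (p q : U ⟶ Faa.ofMon A)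
    (l : Faa.ofMon A ⟶ Faa.ofMon B) (hl : l = (lam C).map u) :
    (lift p q ≫ faaAdd A) ≫ l = lift (p ≫ l) (q ≫ l) ≫ faaAdd B := by
  have h : ∀ (p : U ⟶ Faa.ofMon A) (n : ℕ) {T : C} (a : Fin (n + 1) → (T ⟶ U.mon.X))
      (x : T ⟶ U.base), ev (Z := U) (W := Faa.ofMon B) (p ≫ l) a x =
        ev p a x ≫ toHom u := fun p n T a x => by
    rw [hl]
    exact ev_comp_lin (W := Faa.ofMon A) (V := Faa.ofMon B) p u (toHom u) a x
  have h' : ∀ (p : U ⟶ Faa.ofMon A) {T : C} (x : T ⟶ U.base),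
      x ≫ Faa.Hom.star (p ≫ l) = (x ≫ p.star) ≫ toHom u := fun p T x => by
    rw [hl]
    exact (Category.assoc _ _ _).symm
  refine faa_ext (fun x => ?_) fun n T a x => ?_
  · rw [star_faaAdd, h', h', h', star_faaAdd]
    exact add_comp u _ _
  · rw [ev_faaAdd, h, h, h, ev_faaAdd]
    exact add_comp u _ _

theorem faaMon_prod (A B : CommMon C) : faaMon (prodMon A B) = prodMon (faaMon A) (faaMon B) := by
  have hz : ∀ {D : CommMon C} (u : prodMon A B ⟶ D),
      faaZero (prodMon A B) ≫ (lam C).map u = faaZero D := fun u =>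
    ((lam C).map_comp _ _).symm.trans (congrArg (lam C).map (toHom_injective (one_toHom u)))
  have ha : ∀ {D : CommMon C} (u : prodMon A B ⟶ D),
      faaAdd (prodMon A B) ≫ (lam C).map u =
        ((lam C).map u ⊗ₘ (lam C).map u) ≫ faaAdd D := fun {D} u => by
    have h := faaAdd_lam u (fst (Faa.ofMon (prodMon A B)) (Faa.ofMon (prodMon A B))) (snd _ _)
      _ rfl
    rw [lift_fst_snd, Category.id_comp] at h
    exact h.trans (congrArg (· ≫ faaAdd D)
      (lift_fst_comp_snd_comp ((lam C).map u) ((lam C).map u)))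
  refine commMon_ext ?_ ?_
  · refine CartesianMonoidalCategory.hom_ext (X := Faa.ofMon A) (Y := Faa.ofMon B) _ _ ?_ ?_
    · exact (hz (fstMon A B)).trans (one_toHom (fstMon (faaMon A) (faaMon B))).symm
    · exact (hz (sndMon A B)).trans (one_toHom (sndMon (faaMon A) (faaMon B))).symm
  · refine CartesianMonoidalCategory.hom_ext (X := Faa.ofMon A) (Y := Faa.ofMon B) _ _ ?_ ?_
    · exact (ha (fstMon A B)).trans (mul_toHom (fstMon (faaMon A) (faaMon B))).symm
    · exact (ha (sndMon A B)).trans (mul_toHom (sndMon (faaMon A) (faaMon B))).symm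

noncomputable instance : VectorStructure (Faa C) where
  L Z := faaMon Z.mon
  L_L _ := rfl
  L_prod Z W := faaMon_prod Z.mon W.mon

theorem dev_nil (f : Faa.Hom Z W) {T : C} (b c : Fin 0 → (T ⟶ Z.mon.X)) (a : T ⟶ Z.mon.X)
    (x : T ⟶ Z.base) : dev f b c a x = ev f (fun _ : Fin 1 => a) x := by
  rw [dev, Fintype.sum_empty, add_zero]
  exact congrArg (fun a => ev f a x) (funext fun i => by rw [Fin.fin_one_eq_zero i]; rfl)

/-- Derivatives at a pair of morphisms. -/
theorem ev_lift_deriv (a : U ⟶ Faa.ofMon Z.mon) (c : U ⟶ Z) (f : Z ⟶ W) {T : C} {n : ℕ}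
    (t : Fin (n + 1) → (T ⟶ U.mon.X)) (y : T ⟶ U.base) :
    ev (Z := U) (W := Faa.ofMon W.mon) (lift a c ≫ (Faa.deriv f : Faa.ofMon Z.mon ⊗ Z ⟶ _)) t y =
      ∑ π : OrderedFinpartition (n + 1),
        dev f (fun m => ev a (fun j => t (π.emb m j)) y) (fun m => ev c (fun j => t (π.emb m j)) y)
          (y ≫ a.star) (y ≫ c.star) := by
  refine (ev_comp (lift a c) (Faa.deriv f) t y).trans ?_
  refine Finset.sum_congr rfl fun π _ => ?_
  rw [star_lift]
  simp only [ev_lift]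
  exact ev_deriv_pos f (π.length_pos n.succ_pos) _ _ _ _

theorem star_lift_deriv (a : U ⟶ Faa.ofMon Z.mon) (c : U ⟶ Z) (f : Z ⟶ W) {T : C}
    (y : T ⟶ U.base) :
    y ≫ Faa.Hom.star (lift a c ≫ (Faa.deriv f : Faa.ofMon Z.mon ⊗ Z ⟶ Faa.ofMon W.mon)) =
      dev f (n := 0) Fin.elim0 Fin.elim0 (y ≫ a.star) (y ≫ c.star) := by
  refine (Category.assoc _ _ _).symm.trans ?_
  rw [star_lift, dev_nil]
  exact star_deriv f _ _

theorem dev_deriv (f : Faa.Hom Z W) {T : C} {n : ℕ} (p q r s : Fin n → (T ⟶ Z.mon.X))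
    (p0 q0 r0 : T ⟶ Z.mon.X) (x : T ⟶ Z.base) :
    dev (Faa.deriv f) (fun i => pairMon (p i) (q i)) (fun i => pairMon (r i) (s i))
        (pairMon p0 q0) (lift r0 x) =
      dev f (Fin.cons p0 r : Fin (n + 1) → (T ⟶ Z.mon.X)) (Fin.cons q0 s) r0 x +
        ∑ i, dev f (Function.update r i (p i)) (Function.update s i (q i)) r0 x := by
  rw [dev]
  congr 1
  · rw [← ev_deriv]
    refine congrArg (fun p => ev (Faa.deriv f) p (lift r0 x)) (funext (Fin.cases ?_ fun i => ?_))
    · simp only [Fin.cons_zero]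
    · simp only [Fin.cons_succ]
  · refine Finset.sum_congr rfl fun i _ => ?_
    rw [← ev_deriv_pos f i.pos]
    refine congrArg (fun p => ev (Faa.deriv f) p (lift r0 x)) (funext fun j => ?_)
    by_cases h : j = i
    · subst h; simp only [Function.update_self]
    · simp only [Function.update_of_ne h]

theorem dev_deriv_linear (f : Faa.Hom Z W) {T : C} {n : ℕ} (p r s : Fin n → (T ⟶ Z.mon.X))
    (p0 r0 : T ⟶ Z.mon.X) (x : T ⟶ Z.base) :
    dev (Faa.deriv f) (fun i => pairMon (p i) 0) (fun i => pairMon (r i) (s i))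
        (pairMon p0 0) (lift r0 x) = dev f p s p0 x := by
  rw [dev_deriv f p (fun _ => 0) r s p0 0 r0 x, dev, dev, Fin.sum_univ_succ]
  rw [ev_zero f _ x 1 rfl, zero_add]
  have h1 : ∀ i : Fin n, ev f (Function.update (Fin.cons 0 s : Fin (n + 1) → (T ⟶ Z.mon.X))
      i.succ ((Fin.cons p0 r : Fin (n + 1) → (T ⟶ Z.mon.X)) i.succ)) x = 0 := fun i =>
    ev_zero f _ x 0 (by rw [Function.update_of_ne (Fin.succ_ne_zero i).symm]; rfl)
  simp only [h1, Finset.sum_const_zero, add_zero, Fin.cons_zero, Fin.update_cons_zero]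
  congr 1
  refine Finset.sum_congr rfl fun i _ => ?_
  rw [dev, ev_zero f _ x i.succ (by simp), zero_add, Finset.sum_eq_single i]
  · simp
  · intro j _ hj
    exact ev_zero f _ x i (by rw [Function.update_of_ne hj.symm, Function.update_self])
  · simp

theorem dev_deriv_symm_aux (f : Faa.Hom Z W) {T : C} {n : ℕ} (q r s : Fin n → (T ⟶ Z.mon.X))
    (q0 r0 : T ⟶ Z.mon.X) (x : T ⟶ Z.base) :
    dev (Faa.deriv f) (fun i => pairMon 0 (q i)) (fun i => pairMon (r i) (s i))
        (pairMon 0 q0) (lift r0 x) =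
      ev f (Fin.cons r0 (Fin.cons q0 s : Fin (n + 1) → (T ⟶ Z.mon.X)) :
          Fin (n + 2) → (T ⟶ Z.mon.X)) x +
        ∑ i, ev f (Fin.cons q0 (Function.update s i (r i)) : Fin (n + 1) → (T ⟶ Z.mon.X)) x +
        ∑ i, ev f (Fin.cons r0 (Function.update s i (q i)) : Fin (n + 1) → (T ⟶ Z.mon.X)) x +
        ∑ i, ∑ j, if i = j then 0 else
          ev f (Function.update (Function.update s i (q i)) j (r j)) x := by
  rw [dev_deriv f (fun _ => 0) q r s 0 q0 r0 x]
  simp only [dev]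
  rw [Finset.sum_add_distrib, Fin.sum_univ_succ, ← add_assoc, ← add_assoc]
  rw [ev_zero f (Function.update (Fin.cons q0 s : Fin (n + 1) → (T ⟶ Z.mon.X)) 0
    ((Fin.cons 0 r : Fin (n + 1) → (T ⟶ Z.mon.X)) 0)) x 0 (by simp), add_zero]
  simp only [Fin.cons_succ, Fin.cons_update]
  congr 1
  refine Finset.sum_congr rfl fun i _ => Finset.sum_congr rfl fun j _ => ?_
  split_ifs with h
  · subst h
    exact ev_zero f _ x i (by simp)
  · rw [Function.update_of_ne (Ne.symm h)]

theorem dev_deriv_symm (f : Faa.Hom Z W) {T : C} {n : ℕ} (q r s : Fin n → (T ⟶ Z.mon.X))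
    (q0 r0 : T ⟶ Z.mon.X) (x : T ⟶ Z.base) :
    dev (Faa.deriv f) (fun i => pairMon 0 (q i)) (fun i => pairMon (r i) (s i))
        (pairMon 0 q0) (lift r0 x) =
      dev (Faa.deriv f) (fun i => pairMon 0 (r i)) (fun i => pairMon (q i) (s i))
        (pairMon 0 r0) (lift q0 x) := by
  rw [dev_deriv_symm_aux, dev_deriv_symm_aux]
  have h1 : ev f (Fin.cons r0 (Fin.cons q0 s : Fin (n + 1) → (T ⟶ Z.mon.X)) :
      Fin (n + 2) → (T ⟶ Z.mon.X)) x = ev f (Fin.cons q0 (Fin.cons r0 s :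
        Fin (n + 1) → (T ⟶ Z.mon.X)) : Fin (n + 2) → (T ⟶ Z.mon.X)) x := by
    rw [← ev_symm f _ x (Equiv.swap 0 1)]
    refine congrArg (fun a => ev f a x) (funext (Fin.cases ?_ (Fin.cases ?_ fun i => ?_)))
    · rw [Equiv.swap_apply_left]; rfl
    · rw [show (Fin.succ 0 : Fin (n + 2)) = 1 from rfl, Equiv.swap_apply_right]; rfl
    · rw [Equiv.swap_apply_of_ne_of_ne (Fin.succ_ne_zero _)]
      · rfl
      · exact fun h => Fin.succ_ne_zero i (Fin.succ_injective _ h)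
  rw [h1, Finset.sum_comm (s := Finset.univ) (t := Finset.univ)]
  have h2 : ∀ i j : Fin n, (if j = i then (0 : T ⟶ W.mon.X) else
      ev f (Function.update (Function.update s j (q j)) i (r i)) x) =
      if i = j then 0 else ev f (Function.update (Function.update s i (r i)) j (q j)) x := by
    intro i j
    by_cases h : i = j
    · rw [if_pos h, if_pos h.symm]
    · rw [if_neg h, if_neg (Ne.symm h), Function.update_comm (Ne.symm h)]
  simp only [h2]
  rw [add_right_comm (ev f _ x)]

theorem dev_lin (u : Z.mon ⟶ W.mon) (v : Z.base ⟶ W.base) {T : C} :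
    ∀ {n : ℕ} (b c : Fin (n + 1) → (T ⟶ Z.mon.X)) (a : T ⟶ Z.mon.X) (x : T ⟶ Z.base)
      (y : T ⟶ Z.mon.X), dev (Faa.lin u v) b c a x =
        ev (Faa.lin (Z := Faa.ofMon Z.mon) (W := Faa.ofMon W.mon) u (toHom u)) b y
  | 0, b, c, a, x, y => by
    rw [dev, ev_lin_succ, zero_add, Fin.sum_univ_one, ev_lin_one, Function.update_self, ev_lin_one]
  | n + 1, b, c, a, x, y => by
    rw [dev, ev_lin_succ, zero_add, ev_lin_succ]
    exact Finset.sum_eq_zero fun i _ => ev_lin_succ _ _ _ _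

theorem deriv_lin (u : Z.mon ⟶ W.mon) (v : Z.base ⟶ W.base) :
    (Faa.deriv (Faa.lin u v) : Faa.ofMon Z.mon ⊗ Z ⟶ Faa.ofMon W.mon) =
      fst _ _ ≫ (lam C).map u := by
  refine deriv_ext (W := Faa.ofMon W.mon) (fun a x => ?_) fun n T b c a x => ?_
  · refine (star_deriv (Faa.lin u v) a x).trans ?_
    rw [ev_lin_one]
    exact (lift_fst_assoc _ _ _).symm
  · refine (ev_deriv _ _ _ _ _).trans ?_
    refine (dev_lin u v b c a x a).trans ?_
    refine Eq.trans ?_ (ev_lin_comp (Z := Faa.prod (Faa.ofMon Z.mon) Z) (W := Faa.ofMon Z.mon)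
      (V := Faa.ofMon W.mon) (fstMon Z.mon Z.mon) (fst Z.mon.X Z.base) (Faa.lin u (toHom u))
      _ _).symm
    refine congrArg₂ (fun a x => ev (Faa.lin (Z := Faa.ofMon Z.mon) (W := Faa.ofMon W.mon)
      u (toHom u)) a x) (funext fun i => (pairMon_fst _ _).symm) (lift_fst _ _).symm

theorem dev_pair (f : Faa.Hom U Z) (g : Faa.Hom U W) {T : C} {n : ℕ}
    (b c : Fin n → (T ⟶ U.mon.X)) (a : T ⟶ U.mon.X) (x : T ⟶ U.base) :
    dev (Faa.pair f g) b c a x = pairMon (dev f b c a x) (dev g b c a x) := by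
  rw [dev, dev, dev, pairMon_add, pairMon_sum]
  simp only [ev_pair]

theorem deriv_pair (f : Faa.Hom U Z) (g : Faa.Hom U W) :
    Faa.deriv (Faa.pair f g) = Faa.pair (Faa.deriv f) (Faa.deriv g) := by
  refine deriv_ext (W := Faa.ofMon (prodMon Z.mon W.mon)) (fun a x => ?_) fun n T b c a x => ?_
  · refine (star_deriv (Faa.pair f g) a x).trans ?_
    rw [ev_pair]
    exact (comp_lift _ _ _).symm
  · refine (ev_deriv _ _ _ _ _).trans ?_
    refine Eq.trans ?_ (ev_pair (Faa.deriv f) (Faa.deriv g) _ _).symm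
    rw [dev_pair, ev_deriv, ev_deriv]

theorem deriv_add_left (f : Z ⟶ W) (a b : U ⟶ (faaMon Z.mon).X) (c : U ⟶ Z) :
    (lift (a + b) c ≫ Faa.deriv f : U ⟶ (faaMon W.mon).X) =
      (lift a c ≫ Faa.deriv f : U ⟶ (faaMon W.mon).X) +
        (lift b c ≫ Faa.deriv f : U ⟶ (faaMon W.mon).X) := by
  refine faa_ext (fun x => ?_) fun n T t x => ?_
  · refine (star_lift_deriv _ _ _ _).trans (Eq.trans ?_ (star_add_hom _ _ _).symm)
    refine Eq.trans ?_ (congrArg₂ (· + ·) (star_lift_deriv _ _ _ _) (star_lift_deriv _ _ _ _)).symm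
    refine Eq.trans ?_ (dev_add f _ _ _ _ _ _)
    exact congrArg₂ (fun b a => dev f b _ a _) (funext fun i => i.elim0) (star_add_hom _ _ _)
  · refine (ev_lift_deriv _ _ _ _ _).trans (Eq.trans ?_ (ev_add_hom _ _ _ _).symm)
    refine Eq.trans ?_ (congrArg₂ (· + ·) (ev_lift_deriv _ _ _ _ _)
      (ev_lift_deriv _ _ _ _ _)).symm
    refine Eq.trans ?_ Finset.sum_add_distrib
    refine Finset.sum_congr rfl fun π _ => ?_
    refine Eq.trans ?_ (dev_add f _ _ _ _ _ _)
    exact congrArg₂ (fun b a => dev f b _ a _) (funext fun i => ev_add_hom _ _ _ _)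
      (star_add_hom _ _ _)

theorem deriv_zero_left (f : Z ⟶ W) (c : U ⟶ Z) :
    (lift (0 : U ⟶ (faaMon Z.mon).X) c ≫ Faa.deriv f : U ⟶ (faaMon W.mon).X) = 0 := by
  refine faa_ext (fun x => ?_) fun n T t x => ?_
  · refine (star_lift_deriv _ _ _ _).trans (Eq.trans ?_ (star_zero_hom _).symm)
    refine Eq.trans ?_ (dev_zero f Fin.elim0 (x ≫ c.star))
    exact congrArg₂ (fun b a => dev f b _ a _) (funext fun i => i.elim0) (star_zero_hom _)
  · refine (ev_lift_deriv _ _ _ _ _).trans (Eq.trans ?_ (ev_zero_hom _ _).symm)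
    refine Finset.sum_eq_zero fun π _ => ?_
    refine Eq.trans ?_ (dev_zero f (fun m => ev c (fun j => t (π.emb m j)) x) (x ≫ c.star))
    exact congrArg₂ (fun b a => dev f b _ a _) (funext fun i => ev_zero_hom _ _)
      (star_zero_hom _)

theorem ev_lift_deriv₂ (p q : U ⟶ Faa.ofMon Z.mon) (r : U ⟶ Faa.ofMon Z.mon) (d : U ⟶ Z)
    (f : Z ⟶ W) {T : C} {n : ℕ} (t : Fin (n + 1) → (T ⟶ U.mon.X)) (y : T ⟶ U.base) :
    ev (Z := U) (W := Faa.ofMon W.mon)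
        (Faa.comp _ _ _ (Faa.pair (Faa.pair p q) (Faa.pair r d)) (Faa.deriv (Faa.deriv f))) t y =
      ∑ π : OrderedFinpartition (n + 1),
        dev (Faa.deriv f)
          (fun m => pairMon (ev p (fun j => t (π.emb m j)) y) (ev q (fun j => t (π.emb m j)) y))
          (fun m => pairMon (ev r (fun j => t (π.emb m j)) y) (ev d (fun j => t (π.emb m j)) y))
          (pairMon (y ≫ p.star) (y ≫ q.star)) (lift (y ≫ r.star) (y ≫ d.star)) := by
  refine (ev_comp (Faa.pair (Faa.pair p q) (Faa.pair r d)) (Faa.deriv (Faa.deriv f)) t y).trans ?_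
  refine Finset.sum_congr rfl fun π _ => ?_
  refine Eq.trans ?_ (ev_deriv_pos (Faa.deriv f) (π.length_pos n.succ_pos) _ _ _ _)
  refine congrArg₂ (fun a x => ev (Faa.deriv (Faa.deriv f)) a x) (funext fun m => ?_) ?_
  · rw [ev_pair, ev_pair, ev_pair]
  · refine (comp_lift _ _ _).trans (congrArg₂ lift ?_ ?_) <;> exact comp_lift _ _ _

theorem star_lift_deriv₂ (p q : U ⟶ Faa.ofMon Z.mon) (r : U ⟶ Faa.ofMon Z.mon) (d : U ⟶ Z)
    (f : Z ⟶ W) {T : C} (y : T ⟶ U.base) :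
    y ≫ (Faa.comp _ _ _ (Faa.pair (Faa.pair p q) (Faa.pair r d))
        (Faa.deriv (Faa.deriv f))).star =
      dev (Faa.deriv f) (n := 0) (fun _ => pairMon 0 0) (fun _ => pairMon 0 0)
          (pairMon (y ≫ p.star) (y ≫ q.star)) (lift (y ≫ r.star) (y ≫ d.star)) := by
  rw [dev_nil]
  refine (Category.assoc _ _ _).symm.trans ?_
  refine Eq.trans ?_ (star_deriv (Faa.deriv f) _ _)
  refine congrArg (· ≫ (Faa.deriv (Faa.deriv f)).star) ?_
  refine (comp_lift _ _ _).trans (congrArg₂ lift ?_ ?_) <;> exact comp_lift _ _ _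

theorem deriv_deriv_linear (f : Z ⟶ W) (a c z : U ⟶ Faa.ofMon Z.mon) (d : U ⟶ Z)
    (hz : z = (0 : U ⟶ (faaMon Z.mon).X)) :
    Faa.comp _ _ _ (Faa.pair (Faa.pair a z) (Faa.pair c d))
      (Faa.deriv (Faa.deriv f)) =
    (lift a d ≫ (Faa.deriv f : Faa.ofMon Z.mon ⊗ Z ⟶ Faa.ofMon W.mon)) := by
  have h1 : ∀ {T : C} (x : T ⟶ U.base), x ≫ z.star = (0 : T ⟶ Z.mon.X) := fun x => by
    rw [hz]; exact star_zero_hom x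
  have h2 : ∀ {T : C} {n : ℕ} (t : Fin n → (T ⟶ U.mon.X)) (x : T ⟶ U.base),
      ev z t x = 0 := fun t x => by
    rw [hz]; exact ev_zero_hom t x
  clear hz
  refine faa_ext (Z := U) (W := Faa.ofMon W.mon) (fun x => ?_) fun n T t x => ?_
  · refine (star_lift_deriv₂ a z c d f x).trans (Eq.trans ?_ (star_lift_deriv a d f x).symm)
    rw [h1]
    refine (dev_deriv_linear f (fun _ => 0) (fun _ => 0) (fun _ => 0) _ _ _).trans ?_
    exact congrArg₂ (fun b c => dev f b c _ _) (funext fun i => i.elim0) (funext fun i => i.elim0)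
  · refine (ev_lift_deriv₂ a z c d f t x).trans (Eq.trans ?_ (ev_lift_deriv a d f t x).symm)
    refine Finset.sum_congr rfl fun π _ => ?_
    simp only [h1, h2]
    exact dev_deriv_linear f _ _ _ _ _ _

theorem deriv_deriv_symm (f : Z ⟶ W) (b c z : U ⟶ Faa.ofMon Z.mon) (d : U ⟶ Z)
    (hz : z = (0 : U ⟶ (faaMon Z.mon).X)) :
    Faa.comp _ _ _ (Faa.pair (Faa.pair z b) (Faa.pair c d)) (Faa.deriv (Faa.deriv f)) =
    Faa.comp _ _ _ (Faa.pair (Faa.pair z c) (Faa.pair b d)) (Faa.deriv (Faa.deriv f)) := by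
  have h1 : ∀ {T : C} (x : T ⟶ U.base), x ≫ z.star = (0 : T ⟶ Z.mon.X) := fun x => by
    rw [hz]; exact star_zero_hom x
  have h2 : ∀ {T : C} {n : ℕ} (t : Fin n → (T ⟶ U.mon.X)) (x : T ⟶ U.base),
      ev z t x = 0 := fun t x => by
    rw [hz]; exact ev_zero_hom t x
  clear hz
  refine hom_ext' ((Category.id_comp _).symm.trans (Eq.trans ?_ (Category.id_comp _)))
    fun n T t x => ?_
  · refine (star_lift_deriv₂ _ _ _ _ _ _).trans (Eq.trans ?_ (star_lift_deriv₂ _ _ _ _ _ _).symm)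
    rw [h1]
    exact dev_deriv_symm f (fun _ => 0) (fun _ => 0) (fun _ => 0) _ _ _
  · refine (ev_lift_deriv₂ _ _ _ _ _ _ _).trans (Eq.trans ?_ (ev_lift_deriv₂ _ _ _ _ _ _ _).symm)
    refine Finset.sum_congr rfl fun π _ => ?_
    simp only [h1, h2]
    exact dev_deriv_symm f _ _ _ _ _ _

theorem lift_lift (p q : U ⟶ Faa.ofMon Z.mon) (r : U ⟶ Faa.ofMon Z.mon) (d : U ⟶ Z) :
    lift (lift p q ≫ 𝟙 _) (lift r d) = Faa.pair (Faa.pair p q) (Faa.pair r d) := by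
  rw [Category.comp_id, faa_lift, faa_lift, faa_lift]

/-- `Faà(C)` is a generalized Cartesian differential category. -/
noncomputable instance : GenCartDiffCat (Faa C) where
  D f := Faa.deriv f
  D_add Z := by
    refine (deriv_lin (Z := Faa.ofMon (prodMon Z.mon Z.mon)) (W := Faa.ofMon Z.mon)
      (addMon Z.mon) μ[Z.mon.X]).trans ?_
    refine congrArg (fst _ _ ≫ ·) ?_
    exact (Category.comp_id _).symm.trans (Category.id_comp _).symm
  D_zero Z := by
    refine (deriv_lin (Z := Faa.unit C) (W := Faa.ofMon Z.mon) (zeroMon Z.mon) η[Z.mon.X]).trans ?_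
    refine congrArg (fst _ _ ≫ ·) ?_
    refine Eq.trans ?_ (congrArg (toUnit _ ≫ ·) (Category.comp_id _).symm)
    refine (Category.id_comp ((lam C).map (zeroMon Z.mon))).symm.trans ?_
    exact congrArg (· ≫ (lam C).map (zeroMon Z.mon))
      (toUnit_unique (𝟙 (𝟙_ (Faa C))) (toUnit (𝟙_ (Faa C))))
  add_D f a b c := deriv_add_left f a b c
  zero_D f c := deriv_zero_left f c
  D_fst Z W := by
    refine (deriv_lin (Z := Faa.prod Z W) (W := Z) (fstMon Z.mon W.mon) (fst Z.base W.base)).trans ?_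
    refine congrArg (fst _ _ ≫ ·) ?_
    exact (Category.id_comp _).symm
  D_snd Z W := by
    refine (deriv_lin (Z := Faa.prod Z W) (W := W) (sndMon Z.mon W.mon) (snd Z.base W.base)).trans ?_
    refine congrArg (fst _ _ ≫ ·) ?_
    exact (Category.id_comp _).symm
  D_lift f g := by
    rw [faa_lift]
    refine (deriv_pair f g).trans ?_
    refine (faa_lift (Z := Faa.ofMon _) (W := Faa.ofMon _) _ _).symm.trans ?_
    exact (Category.comp_id _).symm
  D_comp f g := by
    refine (deriv_comp f g).trans ?_
    exact congrArg (fun h => Faa.comp _ _ _ h (Faa.deriv g)) (faa_lift _ _).symm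
  D_D_linear f a c d := by
    refine (congrArg (fun h => Faa.comp _ _ _ h (Faa.deriv (Faa.deriv f)))
      (lift_lift a _ c d)).trans ((deriv_deriv_linear f a c _ d rfl).trans ?_)
    exact (Category.comp_id _).symm.trans (Category.assoc _ _ _)
  D_D_symm f b c d :=
    (congrArg (fun h => Faa.comp _ _ _ h (Faa.deriv (Faa.deriv f)))
      (lift_lift _ b c d)).trans ((deriv_deriv_symm f b c _ d rfl).trans
        (congrArg (fun h => Faa.comp _ _ _ h (Faa.deriv (Faa.deriv f)))
          (lift_lift _ c b d)).symm)

end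

end FaaDiBruno

/-!
For every object `Z = ((A,+,0),X)` of `Faà(C)` the object of vectors of `Z` is `((A,+,0),A)`, so
`Z` is linear exactly when `X = A`; this is the first part.

For the second part let `f = (f_*, f₁, f₂, …)` satisfy `D(f) = π₀f`.  Comparing the maps between
the bases gives `f₁(a,x) = f_*(a)` (`ev_one_of_deriv_eq`).  As `f₁` is additive in its first
variable, `f_*` is an additive map (`starHom`).  Comparing the `n`-th terms, for `n ≥ 1`, gives
`f_{n+1}(a,c₁,…,cₙ,x) + ∑ᵢ fₙ(c₁,…,bᵢ,…,cₙ,x) = fₙ(b₁,…,bₙ,a)`, and at `b₁ = ⋯ = bₙ = 0` only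
`f_{n+1}(a,c₁,…,cₙ,x) = 0` is left (`ev_succ_of_deriv_eq`).  Hence `f = (f_*, π₀f_*, 0, 0, …)`,
which is the image of an additive map under `λ`.  Conversely, `deriv_lin` computes the derivative
of such a morphism.
-/

namespace FaaDiBruno

section

variable {C : Type u} [Category.{v} C] [CartesianMonoidalCategory C] [BraidedCategory C]
variable {A B : CommMon C} {f : Faa.ofMon A ⟶ Faa.ofMon B}

/-- Between objects `((A,+,0),A)` and `((B,+,0),B)`, linearity is the equation `D(f) = π₀f` with
no identification of objects left in it, since `L₀` fixes these objects definitionally. -/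
theorem isLinearMap_iff_deriv_eq :
    IsLinearMap f ↔
      (Faa.deriv f : Faa.ofMon A ⊗ Faa.ofMon A ⟶ Faa.ofMon B) = fst _ _ ≫ f := by
  have h : fst (Faa.ofMon A) (Faa.ofMon A) ≫ 𝟙 (Faa.ofMon A) ≫ f ≫ 𝟙 (Faa.ofMon B) =
      fst _ _ ≫ f := by
    rw [Category.comp_id, Category.id_comp]
  exact ⟨fun ⟨_, _, hf⟩ => Eq.trans hf h, fun hf => ⟨rfl, rfl, hf.trans h.symm⟩⟩

theorem ev_one_of_deriv_eq
    (hf : (Faa.deriv f : Faa.ofMon A ⊗ Faa.ofMon A ⟶ Faa.ofMon B) = fst _ _ ≫ f)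
    {T : C} (a : Fin 1 → (T ⟶ A.X)) (x : T ⟶ A.X) :
    ev f a x = a 0 ≫ f.star := by
  have h : f.term 0 = fst A.X A.X ≫ f.star := congrArg Faa.Hom.star hf
  refine (congrArg (fun t => lift (a 0) x ≫ t) h).trans ?_
  exact lift_fst_assoc _ _ _

theorem ev_succ_of_deriv_eq
    (hf : (Faa.deriv f : Faa.ofMon A ⊗ Faa.ofMon A ⟶ Faa.ofMon B) = fst _ _ ≫ f)
    {T : C} {n : ℕ} (a : Fin (n + 2) → (T ⟶ A.X)) (x : T ⟶ A.X) :
    ev f a x = 0 := by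
  have h := ev_deriv f (fun _ => 0) (Fin.tail a) (a 0) x
  rw [dev_zero_left, Fin.cons_self_tail] at h
  refine h.symm.trans ?_
  refine (congrArg (fun g : Faa.Hom (Faa.prod (Faa.ofMon A) (Faa.ofMon A)) (Faa.ofMon B) =>
    ev g (fun i => pairMon 0 (Fin.tail a i)) (lift (a 0) x)) hf).trans ?_
  refine (ev_lin_comp (Z := Faa.prod (Faa.ofMon A) (Faa.ofMon A)) (W := Faa.ofMon A)
    (V := Faa.ofMon B) (fstMon A A) (fst A.X A.X) f _ _).trans ?_
  exact ev_zero f _ _ 0 (pairMon_fst _ _)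

/-- The additive map underlying a morphism with `D(f) = π₀f`.  It is additive because `f₁`, which
is additive in its first variable, is `π₀f_*`. -/
def starHom
    (hf : (Faa.deriv f : Faa.ofMon A ⊗ Faa.ofMon A ⟶ Faa.ofMon B) = fst _ _ ≫ f) : A ⟶ B :=
  mkHom f.star
    (by
      have h := ev_zero f (fun _ : Fin 1 => (0 : 𝟙_ C ⟶ A.X)) 0 0 rfl
      rw [ev_one_of_deriv_eq hf, zero_def, zero_def, toUnit_unique (toUnit (𝟙_ C)) (𝟙 _),
        Category.id_comp] at h
      exact h.trans (Category.id_comp _))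
    (by
      have h := ev_add f (fun _ : Fin 1 => (0 : A.X ⊗ A.X ⟶ A.X)) 0 0 (fst A.X A.X) (snd A.X A.X)
      simp only [ev_one_of_deriv_eq hf, Function.update_self] at h
      rw [add_def, lift_fst_snd, Category.id_comp] at h
      exact h.trans (congrArg (· ≫ μ[B.X]) (lift_fst_comp_snd_comp f.star f.star)))

theorem eq_lam_map_starHom
    (hf : (Faa.deriv f : Faa.ofMon A ⊗ Faa.ofMon A ⟶ Faa.ofMon B) = fst _ _ ≫ f) :
    f = (lam C).map (starHom hf) := by
  refine hom_ext' rfl fun n T a x => ?_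
  cases n with
  | zero =>
    exact (ev_one_of_deriv_eq hf a x).trans
      (ev_lin_one (Z := Faa.ofMon A) (W := Faa.ofMon B) (starHom hf) (toHom (starHom hf)) a x).symm
  | succ n =>
    exact (ev_succ_of_deriv_eq hf a x).trans
      (ev_lin_succ (Z := Faa.ofMon A) (W := Faa.ofMon B) (starHom hf) (toHom (starHom hf)) a x).symm

end

end FaaDiBruno

theorem mainTheorem5 {C : Type u} [Category.{v} C] [CartesianMonoidalCategory C]
    [BraidedCategory C] :
    (∀ Z : FaaDiBruno.Faa C,
      FaaDiBruno.IsLinearObj Z ↔ ∃ A : CommMon C, Z = FaaDiBruno.Faa.ofMon A) ∧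
    (∀ (A B : CommMon C)
      (f : (FaaDiBruno.lam C).obj A ⟶ (FaaDiBruno.lam C).obj B),
      FaaDiBruno.IsLinearMap f ↔ ∃ u : A ⟶ B, f = (FaaDiBruno.lam C).map u) := by
  refine ⟨fun Z => ⟨fun h => ⟨Z.mon, h.symm⟩, ?_⟩, fun A B f => ?_⟩
  · rintro ⟨A, rfl⟩
    rfl
  · refine FaaDiBruno.isLinearMap_iff_deriv_eq.trans
      ⟨fun hf => ⟨_, FaaDiBruno.eq_lam_map_starHom hf⟩, ?_⟩
    rintro ⟨u, rfl⟩
    exact FaaDiBruno.deriv_lin (Z := FaaDiBruno.Faa.ofMon A) (W := FaaDiBruno.Faa.ofMon B) u _
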